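/- Let $d\ge 2$ be an integer, let $\mathbb{U}$ be the set of finite words over $\{1,2,3,\dots\}$ (with empty word $\varnothing$ and concatenation $*$), and let $\mathbb{U}_d\subset\mathbb{U}$ be the set of words $u=(u_1,\dots,u_n)$, $n\ge 0$, with $u_1\in\{1,\dots,d+1\}$ and $u_i\in\{1,\dots,d\}$ for $2\le i\le n$. For a non-empty word $v$ let $\overleftarrow{v}$ be its parent, i.e. $v$ without its last letter; for a finite set $t\subset\mathbb{U}$ and $u\in\mathbb{U}$ let $\theta_u t=\{w\in\mathbb{U}: u*w\in t\}$. The leaves of $t$ are the words $u\in t$ such that $u*j\notin t$ for all $j\ge 1$. Let $(T_n)_{n\ge 1}$ be the $(d+1)$-regular uniform attachment process: $T_1=\{\varnothing,1,\dots,d+1\}$ and, for $n\ge 1$, $T_{n+1}=T_n\cup\{V_n*1,\dots,V_n*d\}$, where, conditionally given $(T_1,\dots,T_n)$, $V_n$ is a uniformly random leaf of $T_n$. **Proposition.** For every $v\in\mathbb{U}\setminus\{\varnothing\}$ the limit $$D_v=\lim_{n\to\infty}\mathbf{1}_{\{v\in T_n\}}\frac{|\theta_v T_n|}{|\theta_{\overleftarrow{v}}T_n|}$$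 exists almost surely. Put $\mathbf{D}_\varnothing=(D_1,\dots,D_{d+1})$ and $\mathbf{D}_u=(D_{u*1},\dots,D_{u*d})$ for $u\in\mathbb{U}_d\setminus\{\varnothing\}$. Then the random vectors $(\mathbf{D}_u)_{u\in\mathbb{U}_d}$ are independent; moreover $\mathbf{D}_\varnothing\sim\mathrm{Dir}_{d+1}\big(\tfrac1{d-1}\big)$, and $\mathbf{D}_u\sim\mathrm{Dir}_d\big(\tfrac1{d-1}\big)$ for all $u\in\mathbb{U}_d\setminus\{\varnothing\}$. Here $\mathrm{Dir}_k(\alpha)$ is the symmetric Dirichlet distribution, which has density $\frac{\Gamma(k\alpha)}{\Gamma(\alpha)^k}\prod_{j=1}^k x_j^{\alpha-1}$ with respect to $(k-1)$-dimensional Lebesgue measure $dx_1\cdots dx_{k-1}$ on the simplex $\{x\in[0,1]^k: x_1+\dots+x_k=1\}$. -/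

import Mathlib

open MeasureTheory ProbabilityTheory Filter Topology

namespace UniformAttachment

/-- Words over the alphabet of positive integers, the vertices of the Ulam–Harris tree. The word
`u ++ [j]` is the `j`-th child of `u`, and the parent of a non-empty word `v` is `v.dropLast`. -/
abbrev Word : Type := List ℕ+

/-- Words whose first letter is at most `d + 1` and whose other letters are at most `d`. -/
def regularWords (d : ℕ) : Set Word :=
  {u | (∀ a ∈ u.head?, (a : ℕ) ≤ d + 1) ∧ ∀ a ∈ u.tail, (a : ℕ) ≤ d}

/-- The first `k` children `u * 1, …, u * k` of the word `u`. -/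
def children (k : ℕ) (u : Word) : Finset Word :=
  (Finset.range k).image fun j => u ++ [j.succPNat]

open Classical in
/-- The leaves of a tree `t`: the words of `t` without a child in `t`. -/
noncomputable def leaves (t : Finset Word) : Finset Word :=
  t.filter fun u => ∀ j : ℕ+, u ++ [j] ∉ t

/-- The subtree `{v | u * v ∈ t}` of `t` stemming from `u`, empty if `u ∉ t` for a tree `t`. -/
noncomputable def subtree (u : Word) (t : Finset Word) : Finset Word :=
  t.preimage (fun v => u ++ v) (List.append_right_injective u).injOn

/-- `(T n)`, `n ≥ 1`, is the `(d + 1)`-regular uniform attachment process (as plane trees) on the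
probability space `(Ω, μ)`, and `V n` is the leaf of `T n` which receives `d` children at step `n`.
The index `n = 0` plays no role. -/
structure IsRegularUA {Ω : Type*} [MeasurableSpace Ω] (μ : Measure Ω) (d : ℕ)
    (T : ℕ → Ω → Finset Word) (V : ℕ → Ω → Word) : Prop where
  /-- `T n` is a random variable in a countable discrete space. -/
  measurable_tree : ∀ n, 1 ≤ n → ∀ t, MeasurableSet {ω | T n ω = t}
  /-- `V n` is a random variable in a countable discrete space. -/
  measurable_leaf : ∀ n, 1 ≤ n → ∀ v, MeasurableSet {ω | V n ω = v}
  /-- The initial tree is `{∅, 1, …, d + 1}`. -/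
  init : ∀ᵐ ω ∂μ, T 1 ω = insert [] (children (d + 1) [])
  /-- At each step the chosen vertex `V n` receives the children `V n * 1, …, V n * d`. -/
  step : ∀ n, 1 ≤ n → ∀ᵐ ω ∂μ, T (n + 1) ω = T n ω ∪ children d (V n ω)
  /-- Conditionally given `T 1, …, T n`, the vertex `V n` is a uniformly random leaf of `T n`. -/
  uniform : ∀ n, 1 ≤ n → ∀ (t : ℕ → Finset Word) (v : Word),
    μ {ω | (∀ i ∈ Finset.Icc 1 n, T i ω = t i) ∧ V n ω = v} =
      μ {ω | ∀ i ∈ Finset.Icc 1 n, T i ω = t i} *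
        (if v ∈ leaves (t n) then ((leaves (t n)).card : ENNReal)⁻¹ else 0)

/-- The proportion `1_{v ∈ t} |θ_v t| / |θ_p t|`, where `p` is the parent of `v ≠ ∅` and `θ_u t` is
the subtree of `t` stemming from `u`. -/
noncomputable def ratio (v : Word) (t : Finset Word) : ℝ :=
  if v ∈ t then ((subtree v t).card : ℝ) / ((subtree v.dropLast t).card : ℝ) else 0

/-- The limiting proportion `D_v`. -/
noncomputable def limitRatio {Ω : Type*} (T : ℕ → Ω → Finset Word) (v : Word) (ω : Ω) : ℝ :=
  limUnder atTop fun n => ratio v (T n ω)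

/-- The vector `(D_{u * 1}, …, D_{u * k})`. -/
noncomputable def limitRatios {Ω : Type*} (T : ℕ → Ω → Finset Word) (k : ℕ) (u : Word)
    (ω : Ω) : Fin k → ℝ :=
  fun i => limitRatio T (u ++ [(i : ℕ).succPNat]) ω

/-- The number of children of the word `u` in the infinite tree of all `regularWords d`. -/
def arity (d : ℕ) (u : Word) : ℕ := if u = [] then d + 1 else d

/-- The map `(x_1, …, x_{k-1}) ↦ (x_1, …, x_{k-1}, 1 - x_1 - ⋯ - x_{k-1})`, for `k ≥ 1`. -/
noncomputable def simplexPoint (k : ℕ) (x : Fin (k - 1) → ℝ) : Fin k → ℝ :=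
  fun i => if h : (i : ℕ) < k - 1 then x ⟨i, h⟩ else 1 - ∑ j, x j

/-- The density of `Dir(α_1, …, α_k)`, with respect to `(k - 1)`-dimensional Lebesgue measure. -/
noncomputable def dirichletDensity {k : ℕ} (α : Fin k → ℝ) (x : Fin k → ℝ) : ℝ :=
  Real.Gamma (∑ i, α i) / (∏ i, Real.Gamma (α i)) * ∏ i, x i ^ (α i - 1)

/-- The Dirichlet distribution `Dir(α_1, …, α_k)` on `ℝ^k`, for `k ≥ 1` and positive `α_i`. The
`(k - 1)`-dimensional Lebesgue measure on the simplex `{x ∈ [0, 1]^k | x_1 + ⋯ + x_k = 1}` is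
`dx_1 ⋯ dx_{k-1}`. -/
noncomputable def dirichlet {k : ℕ} (α : Fin k → ℝ) : Measure (Fin k → ℝ) :=
  ((volume : Measure (Fin (k - 1) → ℝ)).withDensity
    ({x | simplexPoint k x ∈ stdSimplex ℝ (Fin k)}.indicator fun x =>
      ENNReal.ofReal (dirichletDensity α (simplexPoint k x)))).map (simplexPoint k)

/-- The symmetric Dirichlet distribution `Dir_k(a) = Dir(a, …, a)`. -/
noncomputable def symmDirichlet (k : ℕ) (a : ℝ) : Measure (Fin k → ℝ) :=
  dirichlet fun _ => a

end UniformAttachment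

/-! The process is a nested family of Pólya urns. In a regular tree, a vertex `v ≠ ∅` with `m` inner
vertices at or below it has `(d - 1) (1 / (d - 1) + m)` leaves at or below it
(`IsRegularTree.card_leavesBelow`). Hence, given that the new inner vertex falls strictly below `u`,
it falls below the `i`-th child of `u` with probability proportional to the weight `1 / (d - 1) + m`
of that child, and this weight then grows by one. The children of `u` thus form an urn whose initial
weights all equal `1 / (d - 1)`.

In an urn with present weights `y`, the probability `polya k y a` of a prescribed sequence of future
draws, with colour `i` occurring `a i` times, is a bounded martingale. The product of these
quantities over any finite set of words `u` is still a martingale (`sum_prod_urn_step`): for a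
deepest word `x` of the set, all leaves below `x` act alike on the other urns, so the urn at `x` can
be averaged on its own.

For a single draw the martingale is the proportion of weight itself, which gives almost sure
convergence. Every subtree grows indefinitely by a conditional Borel–Cantelli argument, so size
proportions and weight proportions have the same limits, and `polya k y a` tends to the monomial `∏
D_i ^ a i`. Dominated convergence then identifies every joint moment of the limits with the initial
value of the martingale, a product of values `polya` at constant weight `1 / (d - 1)`. These are the
Dirichlet moments. As moments determine a measure on a cube, finite families of vectors have a
product law, which yields both independence and the marginals. -/

namespace UniformAttachment

/-! ### Rising factorials and Pólya urn probabilities -/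

/-- The rising factorial `x (x + 1) ⋯ (x + n - 1)`. -/
noncomputable def rise (x : ℝ) (n : ℕ) : ℝ := ∏ i ∈ Finset.range n, (x + i)

@[simp] lemma rise_zero (x : ℝ) : rise x 0 = 1 := by simp [rise]

lemma rise_succ (x : ℝ) (n : ℕ) : rise x (n + 1) = rise x n * (x + n) := by
  simp [rise, Finset.prod_range_succ]

lemma rise_succ_left (x : ℝ) (n : ℕ) : rise x (n + 1) = x * rise (x + 1) n := by
  rw [rise, Finset.prod_range_succ', mul_comm, rise]
  simp [add_assoc, add_comm (1 : ℝ)]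

lemma rise_add (x : ℝ) (m n : ℕ) : rise x (m + n) = rise x m * rise (x + m) n := by
  simp only [rise, Finset.prod_range_add, Nat.cast_add, add_assoc]

lemma rise_nonneg {x : ℝ} (hx : 0 ≤ x) (n : ℕ) : 0 ≤ rise x n :=
  Finset.prod_nonneg fun _ _ => by positivity

lemma rise_pos {x : ℝ} (hx : 0 < x) (n : ℕ) : 0 < rise x n :=
  Finset.prod_pos fun _ _ => by positivity

lemma rise_mono {x y : ℝ} (hx : 0 ≤ x) (hxy : x ≤ y) (n : ℕ) : rise x n ≤ rise y n :=
  Finset.prod_le_prod (fun _ _ => by positivity) fun _ _ => by gcongr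

lemma rise_add_one {x : ℝ} (hx : 0 < x) (n : ℕ) : rise (x + 1) n = rise x n * ((x + n) / x) := by
  have h := rise_succ_left x n
  rw [rise_succ] at h
  field_simp
  linarith

lemma rise_mul_le {x y : ℝ} (hx : 0 ≤ x) (hy : 0 ≤ y) (m n : ℕ) :
    rise x m * rise y n ≤ rise (x + y) (m + n) := by
  rw [rise_add]
  exact mul_le_mul (rise_mono hx (by linarith) m)
    (rise_mono hy (by linarith [Nat.cast_nonneg (α := ℝ) m]) n)
    (rise_nonneg hy n) (rise_nonneg (by linarith) m)

lemma prod_rise_le {ι : Type*} (s : Finset ι) (y : ι → ℝ) (hy : ∀ i, 0 ≤ y i) (a : ι → ℕ) :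
    ∏ i ∈ s, rise (y i) (a i) ≤ rise (∑ i ∈ s, y i) (∑ i ∈ s, a i) := by
  classical
  induction s using Finset.induction_on with
  | empty => simp
  | insert i s hi ih =>
    rw [Finset.prod_insert hi, Finset.sum_insert hi, Finset.sum_insert hi]
    exact (mul_le_mul_of_nonneg_left ih (rise_nonneg (hy i) _)).trans
      (rise_mul_le (hy i) (Finset.sum_nonneg fun i _ => hy i) _ _)

/-- In a Pólya urn with `k` colours of weights `y`, the probability that the next draws have
a given sequence of colours in which the colour `i` occurs `a i` times. -/
noncomputable def polya (k : ℕ) (y : ℕ → ℝ) (a : ℕ → ℕ) : ℝ :=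
  (∏ i ∈ Finset.range k, rise (y i) (a i)) /
    rise (∑ i ∈ Finset.range k, y i) (∑ i ∈ Finset.range k, a i)

lemma polya_congr {k : ℕ} {y z : ℕ → ℝ} (h : ∀ i < k, y i = z i) (a : ℕ → ℕ) :
    polya k y a = polya k z a := by
  have h' : ∀ i ∈ Finset.range k, y i = z i := fun i hi => h i (Finset.mem_range.1 hi)
  rw [polya, polya, Finset.sum_congr rfl h',
    Finset.prod_congr rfl fun i hi => by rw [h' i hi]]

lemma polya_nonneg {k : ℕ} {y : ℕ → ℝ} (hy : ∀ i, 0 < y i) (a : ℕ → ℕ) : 0 ≤ polya k y a :=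
  div_nonneg (Finset.prod_nonneg fun i _ => rise_nonneg (hy i).le _)
    (rise_nonneg (Finset.sum_nonneg fun i _ => (hy i).le) _)

lemma polya_le_one {k : ℕ} {y : ℕ → ℝ} (hy : ∀ i, 0 < y i) (a : ℕ → ℕ) : polya k y a ≤ 1 :=
  div_le_one_of_le₀ (prod_rise_le _ y (fun i => (hy i).le) a)
    (rise_nonneg (Finset.sum_nonneg fun i _ => (hy i).le) _)

/-- Weighted by the draw probabilities `y i / ∑ y` and summed over `i`, the correction factors add
up to `1`. This is the martingale property of a single urn. -/
lemma polya_draw {k : ℕ} {y : ℕ → ℝ} (hy : ∀ i, 0 < y i) (a : ℕ → ℕ) {i : ℕ} (hi : i < k) :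
    polya k (fun j => y j + if j = i then 1 else 0) a =
      polya k y a * ((y i + a i) / y i * ((∑ j ∈ Finset.range k, y j) /
        ((∑ j ∈ Finset.range k, y j) + ∑ j ∈ Finset.range k, (a j : ℝ)))) := by
  have hi' : i ∈ Finset.range k := Finset.mem_range.2 hi
  have hs : 0 < ∑ j ∈ Finset.range k, y j := Finset.sum_pos (fun j _ => hy j) ⟨i, hi'⟩
  have h1 : ∏ j ∈ Finset.range k, rise (y j + if j = i then 1 else 0) (a j) =
      (∏ j ∈ Finset.range k, rise (y j) (a j)) * ((y i + a i) / y i) := by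
    rw [← Finset.mul_prod_erase _ _ hi',
      ← Finset.mul_prod_erase _ (fun j => rise (y j) (a j)) hi']
    rw [if_pos rfl, rise_add_one (hy i), Finset.prod_congr rfl (g := fun j => rise (y j) (a j))]
    · ring
    · intro j hj
      simp [Finset.ne_of_mem_erase hj]
  rw [polya, h1, Finset.sum_add_distrib, Finset.sum_ite_eq', if_pos hi', rise_add_one hs, polya]
  have := rise_pos hs (∑ j ∈ Finset.range k, a j)
  have hi0 := hy i
  push_cast
  have : 0 < ∑ j ∈ Finset.range k, y j + ∑ j ∈ Finset.range k, (a j : ℝ) := by positivity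
  field_simp

/-! ### Regular trees and their growth -/

open Classical in
/-- The vertices of a tree which are not leaves. -/
noncomputable def inner (t : Finset Word) : Finset Word := t \ leaves t

lemma mem_inner {t : Finset Word} {u : Word} : u ∈ inner t ↔ u ∈ t ∧ ∃ j : ℕ+, u ++ [j] ∈ t := by
  simp only [inner, leaves, Finset.mem_sdiff, Finset.mem_filter]
  push Not
  tauto

lemma mem_leaves {t : Finset Word} {u : Word} :
    u ∈ leaves t ↔ u ∈ t ∧ ∀ j : ℕ+, u ++ [j] ∉ t := by
  simp [leaves]

/-- The `(i + 1)`-st child of a word. -/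
def child (u : Word) (i : ℕ) : Word := u ++ [i.succPNat]

lemma mem_children {k : ℕ} {u w : Word} {j : ℕ+} :
    u ++ [j] ∈ children k w ↔ u = w ∧ (j : ℕ) ≤ k := by
  simp only [children, Finset.mem_image, Finset.mem_range]
  constructor
  · rintro ⟨i, hi, h⟩
    obtain ⟨rfl, h2⟩ := List.append_inj' h rfl
    simp only [List.cons.injEq, and_true] at h2
    subst h2
    exact ⟨rfl, by simpa using hi⟩
  · rintro ⟨rfl, h⟩
    exact ⟨j.natPred, by have := j.pos; rw [PNat.natPred]; omega, by simp⟩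

lemma nil_notMem_children {k : ℕ} {w : Word} : [] ∉ children k w := by
  simp [children]

lemma child_injective (u : Word) : Function.Injective (child u) := by
  intro i j h
  simpa [child] using h

lemma card_children (k : ℕ) (u : Word) : (children k u).card = k := by
  exact (Finset.card_image_of_injective _ (child_injective u)).trans (Finset.card_range k)

/-- The trees whose inner vertices `u` have exactly the children `u * 1, …, u * (arity d u)`. -/
structure IsRegularTree (d : ℕ) (t : Finset Word) : Prop where
  nil_mem : [] ∈ inner t
  mem_iff : ∀ (u : Word) (j : ℕ+), u ++ [j] ∈ t ↔ u ∈ inner t ∧ (j : ℕ) ≤ arity d u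

lemma isRegularTree_init (d : ℕ) : IsRegularTree d (insert [] (children (d + 1) [])) := by
  have h : ∀ (u : Word) (j : ℕ+), u ++ [j] ∈ insert [] (children (d + 1) []) ↔
      u = [] ∧ (j : ℕ) ≤ d + 1 := by
    intro u j
    rw [Finset.mem_insert, mem_children]
    simp
  have h0 : [] ∈ inner (insert [] (children (d + 1) [])) :=
    mem_inner.2 ⟨by simp, 1, (h _ _).2 ⟨rfl, by simp⟩⟩
  refine ⟨h0, fun u j => ?_⟩
  rw [h]
  constructor
  · rintro ⟨rfl, hj⟩
    exact ⟨h0, by simpa [arity] using hj⟩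
  · rintro ⟨hu, hj⟩
    obtain ⟨-, i, hi⟩ := mem_inner.1 hu
    obtain rfl := ((h _ _).1 hi).1
    exact ⟨rfl, by simpa [arity] using hj⟩

lemma inner_init (d : ℕ) : inner (insert [] (children (d + 1) [])) = {[]} := by
  ext u
  rw [mem_inner, Finset.mem_singleton]
  constructor
  · rintro ⟨-, j, hj⟩
    rw [Finset.mem_insert, mem_children] at hj
    exact (hj.resolve_left (by simp)).1
  · rintro rfl
    exact ⟨by simp, 1, Finset.mem_insert_of_mem (mem_children.2 ⟨rfl, by simp⟩)⟩

lemma mem_union_children {d : ℕ} {t : Finset Word} {u w : Word} {j : ℕ+} :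
    u ++ [j] ∈ t ∪ children d w ↔ u ++ [j] ∈ t ∨ (u = w ∧ (j : ℕ) ≤ d) := by
  rw [Finset.mem_union, mem_children]

lemma inner_step {d : ℕ} (hd : 1 ≤ d) {t : Finset Word} {w : Word} (ht : IsRegularTree d t)
    (hw : w ∈ leaves t) : inner (t ∪ children d w) = insert w (inner t) := by
  ext u
  rw [mem_inner, Finset.mem_insert, mem_inner]
  constructor
  · rintro ⟨-, j, hj⟩
    rcases mem_union_children.1 hj with h | h
    · exact Or.inr ⟨(mem_inner.1 ((ht.mem_iff _ _).1 h).1).1, j, h⟩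
    · exact Or.inl h.1
  · rintro (rfl | ⟨hu, j, hj⟩)
    · exact ⟨Finset.mem_union_left _ (mem_leaves.1 hw).1, 1,
        mem_union_children.2 (Or.inr ⟨rfl, by simpa using hd⟩)⟩
    · exact ⟨Finset.mem_union_left _ hu, j, Finset.mem_union_left _ hj⟩

lemma notMem_inner_of_mem_leaves {t : Finset Word} {w : Word} (hw : w ∈ leaves t) :
    w ∉ inner t := by
  simp [inner, hw]

lemma IsRegularTree.step {d : ℕ} (hd : 1 ≤ d) {t : Finset Word} {w : Word}
    (ht : IsRegularTree d t) (hw : w ∈ leaves t) : IsRegularTree d (t ∪ children d w) := by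
  -- The root is the only vertex of arity `d + 1`. It is never a leaf, so a step always fills a
  -- vertex of arity `d`.
  have hw0 : w ≠ [] := by
    rintro rfl
    exact notMem_inner_of_mem_leaves hw ht.nil_mem
  refine ⟨by rw [inner_step hd ht hw]; exact Finset.mem_insert_of_mem ht.nil_mem, fun u j => ?_⟩
  rw [inner_step hd ht hw, mem_union_children, ht.mem_iff, Finset.mem_insert]
  constructor
  · rintro (h | ⟨rfl, h⟩)
    · exact ⟨Or.inr h.1, h.2⟩
    · exact ⟨Or.inl rfl, by simpa [arity, hw0] using h⟩
  · rintro ⟨rfl | h, h'⟩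
    · exact Or.inr ⟨rfl, by simpa [arity, hw0] using h'⟩
    · exact Or.inl ⟨h, h'⟩

lemma IsRegularTree.mem_of_prefix {d : ℕ} {t : Finset Word} (ht : IsRegularTree d t)
    {v w : Word} (hw : w ∈ t) (hvw : v <+: w) : v ∈ t := by
  induction w using List.reverseRecOn with
  | nil => rwa [List.prefix_nil.1 hvw]
  | append_singleton u j ih =>
    rcases List.prefix_concat_iff.1 hvw with rfl | h
    · exact hw
    · exact ih (mem_inner.1 ((ht.mem_iff _ _).1 hw).1).1 h

/-! ### Counting vertices below a word; weights -/

/-- The inner vertices of a tree which are equal to or below a given word. -/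
noncomputable def innerBelow (t : Finset Word) (v : Word) : Finset Word :=
  (inner t).filter (v <+: ·)

/-- The leaves of a tree which are equal to or below a given word. -/
noncomputable def leavesBelow (t : Finset Word) (v : Word) : Finset Word :=
  (leaves t).filter (v <+: ·)

lemma card_subtree (t : Finset Word) (v : Word) :
    (subtree v t).card = (t.filter (v <+: ·)).card := by
  rw [← Finset.card_image_of_injective (subtree v t) (List.append_right_injective v)]
  congr 1
  ext w
  simp only [subtree, Finset.mem_image, Finset.mem_preimage, Finset.mem_filter]
  constructor
  · rintro ⟨x, hx, rfl⟩
    exact ⟨hx, List.prefix_append _ _⟩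
  · rintro ⟨hw, x, rfl⟩
    exact ⟨x, hw, rfl⟩

lemma card_leavesBelow_add (t : Finset Word) (v : Word) :
    (leavesBelow t v).card + (innerBelow t v).card = (subtree v t).card := by
  classical
  rw [card_subtree, leavesBelow, innerBelow, inner, ← Finset.card_union_of_disjoint,
    ← Finset.filter_union, Finset.union_sdiff_of_subset (show leaves t ⊆ t from Finset.filter_subset _ _)]
  exact Finset.disjoint_filter_filter (Finset.disjoint_sdiff)

/-- Every vertex strictly below `v` has its parent among the inner vertices at or below `v`.
Counting vertices by their parents then gives the size of a subtree. -/
lemma IsRegularTree.filter_prefix {d : ℕ} {t : Finset Word} (ht : IsRegularTree d t) {v : Word}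
    (hv : v ∈ t) : t.filter (v <+: ·) =
      insert v ((innerBelow t v).biUnion fun w => children (arity d w) w) := by
  ext w
  rw [Finset.mem_filter, Finset.mem_insert, Finset.mem_biUnion]
  induction w using List.reverseRecOn with
  | nil =>
    simp only [nil_notMem_children, and_false, exists_false, or_false, List.prefix_nil]
    exact ⟨fun h => h.2.symm, fun h => ⟨h ▸ hv, h.symm⟩⟩
  | append_singleton u j _ =>
    simp only [mem_children, List.prefix_concat_iff, innerBelow, Finset.mem_filter]
    rw [ht.mem_iff]
    constructor
    · rintro ⟨h1, h2 | h2⟩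
      · exact Or.inl h2.symm
      · exact Or.inr ⟨u, ⟨h1.1, h2⟩, rfl, h1.2⟩
    · rintro (h | ⟨x, ⟨h1, h2⟩, rfl, h3⟩)
      · exact ⟨(ht.mem_iff _ _).1 (h ▸ hv), Or.inl h.symm⟩
      · exact ⟨⟨h1, h3⟩, Or.inr h2⟩

lemma IsRegularTree.card_subtree {d : ℕ} {t : Finset Word} (ht : IsRegularTree d t) {v : Word}
    (hv : v ∈ t) : (subtree v t).card =
      1 + d * (innerBelow t v).card + if v = [] then 1 else 0 := by
  classical
  rw [UniformAttachment.card_subtree, ht.filter_prefix hv, Finset.card_insert_of_notMem,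
    Finset.card_biUnion]
  · simp only [card_children]
    have h : ∀ w : Word, arity d w = d + if w = [] then 1 else 0 := by
      intro w
      unfold arity
      split_ifs <;> rfl
    simp only [h, Finset.sum_add_distrib, Finset.sum_const, smul_eq_mul, Finset.sum_ite_eq']
    have : ([] ∈ innerBelow t v) ↔ v = [] := by
      simp [innerBelow, ht.nil_mem]
    simp only [this]
    ring
  · intro x _ y _ hxy
    refine Finset.disjoint_left.2 fun w => ?_
    induction w using List.reverseRecOn with
    | nil => exact fun h => absurd h nil_notMem_children
    | append_singleton u j _ =>
      rw [mem_children, mem_children]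
      rintro ⟨rfl, -⟩ ⟨rfl, -⟩
      exact hxy rfl
  · rw [Finset.mem_biUnion]
    rintro ⟨w, hw, h⟩
    have hvw : v <+: w := (Finset.mem_filter.1 hw).2
    induction v using List.reverseRecOn with
    | nil => exact nil_notMem_children h
    | append_singleton u j _ =>
      obtain rfl := (mem_children.1 h).1
      simpa using hvw.length_le

/-- The weight `1 / (d - 1) + m`, where `m` is the number of inner vertices equal to or below
a given word. -/
noncomputable def weight (d : ℕ) (t : Finset Word) (v : Word) : ℝ :=
  1 / ((d : ℝ) - 1) + (innerBelow t v).card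

lemma weight_pos {d : ℕ} (hd : 2 ≤ d) (t : Finset Word) (v : Word) : 0 < weight d t v := by
  have : (2 : ℝ) ≤ d := by exact_mod_cast hd
  have : 0 < 1 / ((d : ℝ) - 1) := one_div_pos.2 (by linarith)
  unfold weight
  positivity

/-- The source of the parameter `1 / (d - 1)`: filling a leaf removes one leaf and creates `d`, so
leaf counts move in units of `d - 1`, and a single leaf is `1 / (d - 1)` of a unit. -/
lemma IsRegularTree.card_leavesBelow {d : ℕ} (hd : 2 ≤ d) {t : Finset Word}
    (ht : IsRegularTree d t) {v : Word} (hv : v ∈ t) (hv0 : v ≠ []) :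
    ((leavesBelow t v).card : ℝ) = (d - 1) * weight d t v := by
  have h1 := card_leavesBelow_add t v
  rw [ht.card_subtree hv, if_neg hv0] at h1
  have h2 : ((leavesBelow t v).card : ℝ) + (innerBelow t v).card =
    1 + d * (innerBelow t v).card + 0 := by exact_mod_cast h1
  have : (2 : ℝ) ≤ d := by exact_mod_cast hd
  have : (d : ℝ) - 1 ≠ 0 := by linarith
  unfold weight
  field_simp
  linarith

lemma IsRegularTree.card_leaves {d : ℕ} {t : Finset Word} (ht : IsRegularTree d t) :
    ((leaves t).card : ℝ) = 2 + (d - 1) * (inner t).card := by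
  have h1 := card_leavesBelow_add t []
  rw [ht.card_subtree (mem_inner.1 ht.nil_mem).1, if_pos rfl] at h1
  have e1 : leavesBelow t [] = leaves t := by simp [leavesBelow]
  have e2 : innerBelow t [] = inner t := by simp [innerBelow]
  rw [e1, e2] at h1
  have h2 : ((leaves t).card : ℝ) + (inner t).card = 1 + d * (inner t).card + 1 := by
    exact_mod_cast h1
  linarith

lemma card_innerBelow_step {d : ℕ} (hd : 1 ≤ d) {t : Finset Word} {w : Word}
    (ht : IsRegularTree d t) (hw : w ∈ leaves t) (v : Word) :
    (innerBelow (t ∪ children d w) v).card =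
      (innerBelow t v).card + if v <+: w then 1 else 0 := by
  rw [innerBelow, inner_step hd ht hw, Finset.filter_insert, innerBelow]
  split_ifs
  · rw [Finset.card_insert_of_notMem]
    exact fun h => notMem_inner_of_mem_leaves hw (Finset.mem_filter.1 h).1
  · rfl

lemma weight_step {d : ℕ} (hd : 1 ≤ d) {t : Finset Word} {w : Word}
    (ht : IsRegularTree d t) (hw : w ∈ leaves t) (v : Word) :
    weight d (t ∪ children d w) v = weight d t v + if v <+: w then 1 else 0 := by
  rw [weight, card_innerBelow_step hd ht hw, weight]
  push_cast
  ring

/-! ### Harmonicity of products of urn probabilities -/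

/-- The Pólya urn probability for the weights of the children of a word. -/
noncomputable def urn (d : ℕ) (t : Finset Word) (u : Word) (a : ℕ → ℕ) : ℝ :=
  polya (arity d u) (fun i => weight d t (child u i)) a

lemma IsRegularTree.exists_child_prefix {d : ℕ} {t : Finset Word} (ht : IsRegularTree d t)
    {u w : Word} (hw : w ∈ leaves t) (hu : u ∈ inner t) (huw : u <+: w) :
    ∃ i < arity d u, child u i <+: w := by
  obtain ⟨x, rfl⟩ := huw
  rcases x with _ | ⟨j, x⟩
  · rw [List.append_nil] at hw
    exact absurd hu (notMem_inner_of_mem_leaves hw)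
  · have hp : u ++ [j] <+: u ++ j :: x := ⟨x, by simp⟩
    have := ((ht.mem_iff _ _).1 (ht.mem_of_prefix (mem_leaves.1 hw).1 hp)).2
    refine ⟨j.natPred, ?_, by simp [child, hp]⟩
    have := j.pos
    rw [PNat.natPred]
    omega

lemma child_prefix_eq {u w : Word} {i j : ℕ} (hi : child u i <+: w) (hj : child u j <+: w) :
    i = j := by
  have : child u i = child u j := (List.prefix_of_prefix_length_le hi hj (by simp [child])).eq_of_length
    (by simp [child])
  exact child_injective u this

lemma prefix_of_child_prefix {u w : Word} {i : ℕ} (hi : child u i <+: w) : u <+: w :=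
  (List.prefix_append u _).trans hi

lemma IsRegularTree.leavesBelow_eq_biUnion {d : ℕ} {t : Finset Word} (ht : IsRegularTree d t)
    {u : Word} (hu : u ∈ inner t) : leavesBelow t u =
      (Finset.range (arity d u)).biUnion fun i => leavesBelow t (child u i) := by
  ext w
  simp only [leavesBelow, Finset.mem_filter, Finset.mem_biUnion, Finset.mem_range]
  constructor
  · rintro ⟨h1, h2⟩
    obtain ⟨i, hi, h⟩ := ht.exists_child_prefix h1 hu h2
    exact ⟨i, hi, h1, h⟩
  · rintro ⟨i, hi, h1, h⟩
    exact ⟨h1, prefix_of_child_prefix h⟩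

lemma pairwiseDisjoint_leavesBelow_child (t : Finset Word) (u : Word) (s : Set ℕ) :
    s.PairwiseDisjoint fun i => leavesBelow t (child u i) := by
  intro i _ j _ hij
  refine Finset.disjoint_left.2 fun w h1 h2 => hij ?_
  exact child_prefix_eq (Finset.mem_filter.1 h1).2 (Finset.mem_filter.1 h2).2

lemma IsRegularTree.child_mem_iff {d : ℕ} {t : Finset Word} (ht : IsRegularTree d t) {u : Word}
    {i : ℕ} : child u i ∈ t ↔ u ∈ inner t ∧ i < arity d u := by
  rw [child, ht.mem_iff]
  simp

lemma IsRegularTree.card_leavesBelow_child {d : ℕ} (hd : 2 ≤ d) {t : Finset Word}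
    (ht : IsRegularTree d t) {u : Word} (hu : u ∈ inner t) {i : ℕ} (hi : i < arity d u) :
    ((leavesBelow t (child u i)).card : ℝ) = (d - 1) * weight d t (child u i) :=
  ht.card_leavesBelow hd (ht.child_mem_iff.2 ⟨hu, hi⟩) (by simp [child])

lemma IsRegularTree.card_leavesBelow_eq_sum {d : ℕ} (hd : 2 ≤ d) {t : Finset Word}
    (ht : IsRegularTree d t) {u : Word} (hu : u ∈ inner t) : ((leavesBelow t u).card : ℝ) =
      (d - 1) * ∑ i ∈ Finset.range (arity d u), weight d t (child u i) := by
  rw [ht.leavesBelow_eq_biUnion hu,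
    Finset.card_biUnion (pairwiseDisjoint_leavesBelow_child t u _), Nat.cast_sum, Finset.mul_sum]
  exact Finset.sum_congr rfl fun i hi =>
    ht.card_leavesBelow_child hd hu (Finset.mem_range.1 hi)

lemma IsRegularTree.sum_weight_child {d : ℕ} (hd : 2 ≤ d) {t : Finset Word}
    (ht : IsRegularTree d t) {u : Word} (hu : u ∈ inner t) :
    ∑ i ∈ Finset.range (arity d u), weight d t (child u i) =
      (1 + if u = [] then 1 else 0) / ((d : ℝ) - 1) + (innerBelow t u).card := by
  have h1 := card_leavesBelow_add t u
  rw [ht.card_subtree (mem_inner.1 hu).1] at h1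
  have h2 : ((leavesBelow t u).card : ℝ) + (innerBelow t u).card =
    1 + d * (innerBelow t u).card + if u = [] then 1 else 0 := by exact_mod_cast h1
  rw [ht.card_leavesBelow_eq_sum hd hu] at h2
  have : (2 : ℝ) ≤ d := by exact_mod_cast hd
  have : (d : ℝ) - 1 ≠ 0 := by linarith
  field_simp
  linarith

/-- Group the leaves by the child of `u` they lie below. Child `i` contributes a multiple of `y i +
a i`, and the sum of these over `i` cancels the denominator in `polya_draw`. -/
lemma sum_urn_below {d : ℕ} (hd : 2 ≤ d) {t : Finset Word} (ht : IsRegularTree d t) {u : Word}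
    (hu : u ∈ inner t) (a : ℕ → ℕ) :
    ∑ w ∈ leavesBelow t u, urn d (t ∪ children d w) u a = (leavesBelow t u).card * urn d t u a := by
  classical
  set k := arity d u with hk
  set y : ℕ → ℝ := fun i => weight d t (child u i) with hy
  have hy0 : ∀ i, 0 < y i := fun i => weight_pos hd _ _
  have hk0 : 0 < k := by
    rw [hk, arity]
    split_ifs <;> omega
  have hs : 0 < ∑ i ∈ Finset.range k, y i :=
    Finset.sum_pos (fun i _ => hy0 i) ⟨0, Finset.mem_range.2 hk0⟩
  have hcard : ∀ i ∈ Finset.range k, ((leavesBelow t (child u i)).card : ℝ) = (d - 1) * y i :=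
    fun i hi => ht.card_leavesBelow_child hd hu (Finset.mem_range.1 hi)
  rw [ht.card_leavesBelow_eq_sum hd hu, ht.leavesBelow_eq_biUnion hu,
    Finset.sum_biUnion (pairwiseDisjoint_leavesBelow_child t u _)]
  have hterm : ∀ i ∈ Finset.range k,
      ∑ w ∈ leavesBelow t (child u i), urn d (t ∪ children d w) u a =
        (y i + a i) * ((d - 1) * urn d t u a * ((∑ j ∈ Finset.range k, y j) /
        ((∑ j ∈ Finset.range k, y j) + ∑ j ∈ Finset.range k, (a j : ℝ)))) := by
    intro i hi
    have : ∀ w ∈ leavesBelow t (child u i), urn d (t ∪ children d w) u a =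
        urn d t u a * ((y i + a i) / y i * ((∑ j ∈ Finset.range k, y j) /
        ((∑ j ∈ Finset.range k, y j) + ∑ j ∈ Finset.range k, (a j : ℝ)))) := by
      intro w hw
      have hw' := Finset.mem_filter.1 hw
      rw [urn, urn, ← polya_draw hy0 a (Finset.mem_range.1 hi)]
      refine polya_congr (fun j hj => ?_) a
      rw [weight_step (by omega) ht hw'.1]
      congr 2
      exact propext ⟨fun h => child_prefix_eq h hw'.2, fun h => h ▸ hw'.2⟩
    rw [Finset.sum_congr rfl this, Finset.sum_const, nsmul_eq_mul, hcard i hi]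
    have := hy0 i
    field_simp
  rw [Finset.sum_congr rfl hterm, ← Finset.sum_mul, Finset.sum_add_distrib]
  have : 0 < ∑ j ∈ Finset.range k, y j + ∑ j ∈ Finset.range k, (a j : ℝ) := by positivity
  field_simp
  change _ = (d - 1) * urn d t u a * ∑ i ∈ Finset.range k, y i
  ring

lemma urn_step_of_not_prefix {d : ℕ} (hd : 1 ≤ d) {t : Finset Word} (ht : IsRegularTree d t)
    {u w : Word} (hw : w ∈ leaves t) (h : ∀ i < arity d u, ¬ child u i <+: w) (a : ℕ → ℕ) :
    urn d (t ∪ children d w) u a = urn d t u a :=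
  polya_congr (fun i hi => by rw [weight_step hd ht hw, if_neg (h i hi), add_zero]) a

/-- If `u` is shorter than `x`, then `x` already decides which child of `u` lies above the leaf. If
`u` and `x` are distinct of equal length, no leaf below `x` is below `u`. -/
lemma urn_step_congr {d : ℕ} (hd : 1 ≤ d) {t : Finset Word} (ht : IsRegularTree d t)
    {u x w w' : Word} (hw : w ∈ leaves t) (hw' : w' ∈ leaves t) (hxw : x <+: w) (hxw' : x <+: w')
    (hux : u.length ≤ x.length) (hne : u ≠ x) (a : ℕ → ℕ) :
    urn d (t ∪ children d w) u a = urn d (t ∪ children d w') u a := by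
  refine polya_congr (fun i _ => ?_) a
  rw [weight_step hd ht hw, weight_step hd ht hw']
  congr 2
  rcases hux.lt_or_eq with h | h
  · have key : ∀ z, x <+: z → (child u i <+: z ↔ child u i <+: x) := fun z hz =>
      ⟨fun h' => List.prefix_of_prefix_length_le h' hz (by simpa [child] using h),
        fun h' => h'.trans hz⟩
    rw [key w hxw, key w' hxw']
  · have key : ∀ z, x <+: z → ¬ child u i <+: z := fun z hz h' => hne <|
      (List.prefix_of_prefix_length_le (prefix_of_child_prefix h') hz h.le).eq_of_length h
    simp [key w hxw, key w' hxw']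

/-- The product of Pólya urn probabilities is harmonic for the uniform attachment dynamics. -/
lemma sum_prod_urn_step {d : ℕ} (hd : 2 ≤ d) {t : Finset Word} (ht : IsRegularTree d t)
    (a : Word → ℕ → ℕ) (S : Finset Word) :
    ∑ w ∈ leaves t, ∏ u ∈ S, urn d (t ∪ children d w) u (a u) =
      (leaves t).card * ∏ u ∈ S, urn d t u (a u) := by
  induction S using Finset.induction_on_max_value (fun u : Word => u.length) with
  | empty => simp
  | insert x S hx hmax ih =>
    have hsub : leavesBelow t x ⊆ leaves t := Finset.filter_subset _ _
    -- With `x` of maximal length, its urn may be frozen at its present value inside the sum. Away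
    -- from `x` this holds termwise; below `x` it holds because the remaining product is constant
    -- there.
    suffices h : ∑ w ∈ leaves t, ∏ u ∈ insert x S, urn d (t ∪ children d w) u (a u) =
        ∑ w ∈ leaves t, urn d t x (a x) * ∏ u ∈ S, urn d (t ∪ children d w) u (a u) by
      rw [h, ← Finset.mul_sum, ih, Finset.prod_insert hx]
      ring
    simp_rw [Finset.prod_insert hx]
    rw [← Finset.sum_sdiff hsub, ← Finset.sum_sdiff hsub]
    congr 1
    · refine Finset.sum_congr rfl fun w hw => ?_
      obtain ⟨hw1, hw2⟩ := Finset.mem_sdiff.1 hw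
      rw [urn_step_of_not_prefix (by omega) ht hw1]
      exact fun i _ h => hw2 (Finset.mem_filter.2 ⟨hw1, prefix_of_child_prefix h⟩)
    · by_cases hx' : x ∈ inner t
      · rcases (leavesBelow t x).eq_empty_or_nonempty with he | ⟨w', hw'⟩
        · simp [he]
        · have hc : ∀ w ∈ leavesBelow t x, ∏ u ∈ S, urn d (t ∪ children d w) u (a u) =
              ∏ u ∈ S, urn d (t ∪ children d w') u (a u) := by
            intro w hw
            refine Finset.prod_congr rfl fun u hu => ?_
            exact urn_step_congr (by omega) ht (Finset.mem_filter.1 hw).1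
              (Finset.mem_filter.1 hw').1 (Finset.mem_filter.1 hw).2 (Finset.mem_filter.1 hw').2
              (hmax u hu) (fun h => hx (h ▸ hu)) _
          rw [Finset.sum_congr rfl fun w hw => by rw [hc w hw], ← Finset.sum_mul,
            sum_urn_below hd ht hx',
            Finset.sum_congr rfl fun w hw => by rw [hc w hw], Finset.sum_const, nsmul_eq_mul]
          ring
      -- If `x` is not an inner vertex, no child of `x` belongs to `t`, so no leaf lies below such a
      -- child and the urn at `x` has not started.
      · refine Finset.sum_congr rfl fun w hw => ?_
        have hw1 := (Finset.mem_filter.1 hw).1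
        rw [urn_step_of_not_prefix (by omega) ht hw1]
        intro i _ h
        refine hx' ((ht.mem_iff x i.succPNat).1 (ht.mem_of_prefix (mem_leaves.1 hw1).1 h)).1

/-! ### Conditioning on the history and martingales -/

instance : MeasurableSpace Word := ⊤

instance : DiscreteMeasurableSpace Word := ⟨fun _ => trivial⟩

instance : DiscreteMeasurableSpace (Finset Word) :=
  ⟨fun s => (Set.to_countable s).measurableSet⟩

/-- The first `n` trees of a sequence of random trees. -/
def history {Ω : Type*} (T : ℕ → Ω → Finset Word) (n : ℕ) (ω : Ω) :
    Finset.Icc 1 n → Finset Word :=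
  fun i => T i ω

lemma measurableSet_historySpace (n : ℕ) (s : Set (Finset.Icc 1 n → Finset Word)) :
    MeasurableSet s := (Set.to_countable s).measurableSet

lemma measurable_comap_history {Ω β : Type*} [MeasurableSpace β] {T : ℕ → Ω → Finset Word}
    {m n : ℕ} (hm : 1 ≤ m) (hmn : m ≤ n) (F : Finset Word → β) :
    Measurable[MeasurableSpace.comap (history T n) inferInstance] fun ω => F (T m ω) :=
  fun s _ => ⟨{h | F (h ⟨m, Finset.mem_Icc.2 ⟨hm, hmn⟩⟩) ∈ s}, measurableSet_historySpace n _, rfl⟩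

/-- A realization of the regular uniform attachment process. -/
structure IsGrowth (d : ℕ) (t : ℕ → Finset Word) (v : ℕ → Word) : Prop where
  init : t 1 = insert [] (children (d + 1) [])
  mem_leaves : ∀ n, 1 ≤ n → v n ∈ leaves (t n)
  step : ∀ n, 1 ≤ n → t (n + 1) = t n ∪ children d (v n)

lemma IsGrowth.isRegularTree {d : ℕ} (hd : 2 ≤ d) {t : ℕ → Finset Word} {v : ℕ → Word}
    (h : IsGrowth d t v) {n : ℕ} (hn : 1 ≤ n) : IsRegularTree d (t n) := by
  induction n, hn using Nat.le_induction with
  | base => rw [h.init]; exact isRegularTree_init d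
  | succ n hn ih => rw [h.step n hn]; exact ih.step (by omega) (h.mem_leaves n hn)

lemma IsGrowth.card_innerBelow_succ {d : ℕ} (hd : 2 ≤ d) {t : ℕ → Finset Word} {v : ℕ → Word}
    (h : IsGrowth d t v) {n : ℕ} (hn : 1 ≤ n) (u : Word) :
    (innerBelow (t (n + 1)) u).card =
      (innerBelow (t n) u).card + if u <+: v n then 1 else 0 := by
  rw [h.step n hn]
  exact card_innerBelow_step (by omega) (h.isRegularTree hd hn) (h.mem_leaves n hn) u

lemma IsGrowth.card_inner {d : ℕ} (hd : 2 ≤ d) {t : ℕ → Finset Word} {v : ℕ → Word}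
    (h : IsGrowth d t v) {n : ℕ} (hn : 1 ≤ n) : (innerBelow (t n) []).card = n := by
  induction n, hn using Nat.le_induction with
  | base => rw [innerBelow, h.init, inner_init]; simp
  | succ n hn ih => rw [h.card_innerBelow_succ hd hn, ih]; simp

section

variable {Ω : Type*} [MeasurableSpace Ω] {μ : Measure Ω} {d : ℕ}
  {T : ℕ → Ω → Finset Word} {V : ℕ → Ω → Word}

lemma IsRegularUA.measurable_T (hT : IsRegularUA μ d T V) {n : ℕ} (hn : 1 ≤ n) :
    Measurable (T n) :=
  measurable_to_countable' fun t => hT.measurable_tree n hn t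

lemma IsRegularUA.measurable_V (hT : IsRegularUA μ d T V) {n : ℕ} (hn : 1 ≤ n) :
    Measurable (V n) :=
  measurable_to_countable' fun v => hT.measurable_leaf n hn v

lemma IsRegularUA.measurable_history (hT : IsRegularUA μ d T V) (n : ℕ) :
    Measurable (history T n) :=
  measurable_pi_lambda _ fun i => hT.measurable_T (Finset.mem_Icc.1 i.2).1

lemma IsRegularUA.measure_history_leaf (hT : IsRegularUA μ d T V) {n : ℕ} (hn : 1 ≤ n)
    (h : Finset.Icc 1 n → Finset Word) (v : Word) :
    μ (history T n ⁻¹' {h} ∩ V n ⁻¹' {v}) = μ (history T n ⁻¹' {h}) *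
      (if v ∈ leaves (h ⟨n, by simpa⟩) then
        ((leaves (h ⟨n, by simpa⟩)).card : ENNReal)⁻¹ else 0) := by
  let t : ℕ → Finset Word := fun i => if hi : i ∈ Finset.Icc 1 n then h ⟨i, hi⟩ else ∅
  have ht : ∀ ω, (∀ i ∈ Finset.Icc 1 n, T i ω = t i) ↔ history T n ω = h := by
    intro ω
    rw [funext_iff, Subtype.forall]
    refine forall₂_congr fun i hi => ?_
    simp only [t, dif_pos hi, history]
  have hn' : n ∈ Finset.Icc 1 n := by simpa
  have := hT.uniform n hn t v
  simp only [ht] at this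
  have htn : t n = h ⟨n, hn'⟩ := dif_pos hn'
  rw [htn] at this
  exact this

lemma IsRegularUA.ae_mem_leaves (hT : IsRegularUA μ d T V) {n : ℕ} (hn : 1 ≤ n) :
    ∀ᵐ ω ∂μ, V n ω ∈ leaves (T n ω) := by
  have h : ∀ᵐ ω ∂μ, ∀ (h : Finset.Icc 1 n → Finset Word) (v : Word),
      v ∉ leaves (h ⟨n, by simpa⟩) → ω ∉ history T n ⁻¹' {h} ∩ V n ⁻¹' {v} := by
    rw [ae_all_iff]
    intro h
    rw [ae_all_iff]
    intro v
    by_cases hv : v ∈ leaves (h ⟨n, by simpa⟩)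
    · exact ae_of_all _ fun ω h => absurd hv h
    · have := hT.measure_history_leaf hn h v
      rw [if_neg hv, mul_zero] at this
      filter_upwards [measure_eq_zero_iff_ae_notMem.1 this] with ω hω _ using hω
  filter_upwards [h] with ω hω
  by_contra hv
  exact hω (history T n ω) (V n ω) hv ⟨rfl, rfl⟩

lemma IsRegularUA.ae_isGrowth (hT : IsRegularUA μ d T V) :
    ∀ᵐ ω ∂μ, IsGrowth d (fun n => T n ω) (fun n => V n ω) := by
  have h1 : ∀ᵐ ω ∂μ, ∀ n, 1 ≤ n → V n ω ∈ leaves (T n ω) :=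
    ae_all_iff.2 fun n => by
      by_cases hn : 1 ≤ n
      · filter_upwards [hT.ae_mem_leaves hn] with ω hω _ using hω
      · exact ae_of_all _ fun ω h => absurd h hn
  have h2 : ∀ᵐ ω ∂μ, ∀ n, 1 ≤ n → T (n + 1) ω = T n ω ∪ children d (V n ω) :=
    ae_all_iff.2 fun n => by
      by_cases hn : 1 ≤ n
      · filter_upwards [hT.step n hn] with ω hω _ using hω
      · exact ae_of_all _ fun ω h => absurd h hn
  filter_upwards [hT.init, h1, h2] with ω h0 h1 h2 using ⟨h0, h1, h2⟩

/-- The mean of a function over the leaves of a tree. -/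
noncomputable def leafMean (K : Finset Word → Word → ℝ) (t : Finset Word) : ℝ :=
  (∑ w ∈ leaves t, K t w) / (leaves t).card

lemma abs_leafMean_le {K : Finset Word → Word → ℝ} {C : ℝ} (hC : 0 ≤ C)
    (hK : ∀ t w, |K t w| ≤ C) (t : Finset Word) : |leafMean K t| ≤ C := by
  rw [leafMean, abs_div, Nat.abs_cast]
  refine div_le_of_le_mul₀ (by positivity) hC ((Finset.abs_sum_le_sum_abs _ _).trans ?_)
  refine (Finset.sum_le_card_nsmul _ _ C fun w _ => hK t w).trans ?_
  rw [nsmul_eq_mul, mul_comm]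


lemma IsRegularUA.setIntegral_history [IsFiniteMeasure μ] (hT : IsRegularUA μ d T V) {n : ℕ} (hn : 1 ≤ n)
    (K : Finset Word → Word → ℝ) (h : Finset.Icc 1 n → Finset Word) :
    ∫ ω in history T n ⁻¹' {h}, leafMean K (T n ω) ∂μ =
      ∫ ω in history T n ⁻¹' {h}, K (T n ω) (V n ω) ∂μ := by
  have hmeas : MeasurableSet (history T n ⁻¹' {h}) :=
    hT.measurable_history n (measurableSet_historySpace n _)
  set t := h ⟨n, by simpa⟩ with ht
  have hTn : ∀ ω ∈ history T n ⁻¹' {h}, T n ω = t := by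
    intro ω hω
    exact congrFun (show history T n ω = h from hω) ⟨n, by simpa⟩
  have hV : ∀ w, MeasurableSet (V n ⁻¹' {w}) := fun w => hT.measurable_leaf n hn w
  have e1 : ∫ ω in history T n ⁻¹' {h}, leafMean K (T n ω) ∂μ =
      μ.real (history T n ⁻¹' {h}) * leafMean K t := by
    rw [setIntegral_congr_fun hmeas (g := fun _ => leafMean K t)
      fun ω hω => by simp only [hTn ω hω], setIntegral_const, smul_eq_mul]
  have e2 : ∫ ω in history T n ⁻¹' {h}, K (T n ω) (V n ω) ∂μ =
      ∫ ω in history T n ⁻¹' {h}, ∑ w ∈ leaves t, (V n ⁻¹' {w}).indicator (fun _ => K t w) ω ∂μ := by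
    refine setIntegral_congr_ae hmeas ?_
    filter_upwards [hT.ae_mem_leaves hn] with ω hω hω'
    rw [hTn ω hω'] at hω ⊢
    rw [Finset.sum_eq_single_of_mem (V n ω) hω]
    · simp
    · intro w _ hw
      simp [hw.symm]
  rw [e1, e2, integral_finsetSum]
  · rw [leafMean, Finset.sum_div, Finset.mul_sum]
    refine Finset.sum_congr rfl fun w hw => ?_
    rw [integral_indicator (hV w), setIntegral_const, smul_eq_mul, measureReal_restrict_apply (hV w),
      Set.inter_comm, Measure.real, Measure.real, hT.measure_history_leaf hn h w, if_pos hw, ENNReal.toReal_mul,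
      ENNReal.toReal_inv, ENNReal.toReal_natCast]
    ring
  · intro w _
    exact (integrable_const _).indicator (hV w)

/-- There are countably many histories, so every event of the generated σ-algebra is a countable
disjoint union of events on which the history is fixed, and on each of these the integrals agree by
the uniform choice of the leaf. -/
lemma IsRegularUA.condExp_history [IsFiniteMeasure μ] (hT : IsRegularUA μ d T V) {n : ℕ} (hn : 1 ≤ n)
    {K : Finset Word → Word → ℝ} {C : ℝ} (hK : ∀ t w, |K t w| ≤ C) :
    μ[fun ω => K (T n ω) (V n ω) | MeasurableSpace.comap (history T n) inferInstance] =ᵐ[μ]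
      fun ω => leafMean K (T n ω) := by
  have hC : 0 ≤ C := (abs_nonneg _).trans (hK ∅ [])
  have hle := (hT.measurable_history n).comap_le
  have hm1 : Measurable fun ω => K (T n ω) (V n ω) :=
    (Measurable.of_discrete (f := fun p : Finset Word × Word => K p.1 p.2)).comp
      ((hT.measurable_T hn).prodMk (hT.measurable_V hn))
  have hi1 : Integrable (fun ω => K (T n ω) (V n ω)) μ :=
    Integrable.of_bound hm1.aestronglyMeasurable C (ae_of_all _ fun ω => hK _ _)
  have hm2 : Measurable[MeasurableSpace.comap (history T n) inferInstance]
      fun ω => leafMean K (T n ω) := measurable_comap_history hn le_rfl _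
  have hi2 : Integrable (fun ω => leafMean K (T n ω)) μ :=
    Integrable.of_bound (hm2.mono hle le_rfl).aestronglyMeasurable C
      (ae_of_all _ fun ω => abs_leafMean_le hC hK _)
  refine (ae_eq_condExp_of_forall_setIntegral_eq hle hi1 (fun _ _ _ => hi2.integrableOn) ?_
    hm2.aestronglyMeasurable).symm
  rintro _ ⟨A, -, rfl⟩ -
  have hA : history T n ⁻¹' A = ⋃ h : A, history T n ⁻¹' {h.1} := by
    ext ω
    simp
  have hdisj : Pairwise (Function.onFun Disjoint fun h : A => history T n ⁻¹' {h.1}) := by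
    intro x y hxy
    refine Disjoint.preimage _ ?_
    simpa [Subtype.ext_iff] using hxy
  have hmeas : ∀ h : A, MeasurableSet (history T n ⁻¹' {h.1}) := fun h =>
    hT.measurable_history n (measurableSet_historySpace n _)
  rw [hA, integral_iUnion hmeas hdisj hi2.integrableOn, integral_iUnion hmeas hdisj hi1.integrableOn]
  exact tsum_congr fun h => hT.setIntegral_history hn K h.1

/-- The filtration generated by the trees; the index is shifted so as to start at `0`. -/
def IsRegularUA.filtration {m : MeasurableSpace Ω} {μ : Measure Ω} (hT : IsRegularUA μ d T V) :
    Filtration ℕ m where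
  seq n := MeasurableSpace.comap (history T (n + 1)) inferInstance
  mono' := by
    intro k n hkn
    rintro _ ⟨A, -, rfl⟩
    exact ⟨{h | (fun i : Finset.Icc 1 (k + 1) =>
      h ⟨i.1, Finset.Icc_subset_Icc_right (by omega) i.2⟩) ∈ A}, measurableSet_historySpace _ _, rfl⟩
  le' n := (hT.measurable_history (n + 1)).comap_le

lemma IsRegularUA.measurable_filtration (hT : IsRegularUA μ d T V) {β : Type*} [MeasurableSpace β]
    {m n : ℕ} (hm : 1 ≤ m) (hmn : m ≤ n + 1) (F : Finset Word → β) :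
    Measurable[hT.filtration n] fun ω => F (T m ω) :=
  measurable_comap_history hm hmn F

lemma IsRegularUA.martingale [IsProbabilityMeasure μ] (hT : IsRegularUA μ d T V) (hd : 2 ≤ d) {F : Finset Word → ℝ} {C : ℝ}
    (hF : ∀ t, |F t| ≤ C) (hharm : ∀ t, IsRegularTree d t →
      ∑ w ∈ leaves t, F (t ∪ children d w) = (leaves t).card * F t) :
    Martingale (fun n ω => F (T (n + 1) ω)) hT.filtration μ := by
  have hm : ∀ n, Measurable[hT.filtration n] fun ω => F (T (n + 1) ω) := fun n =>
    hT.measurable_filtration (by omega) le_rfl F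
  refine martingale_nat (fun n => (hm n).stronglyMeasurable) (fun n => ?_) fun n => ?_
  · exact Integrable.of_bound ((hm n).mono (hT.filtration.le n) le_rfl).aestronglyMeasurable C
      (ae_of_all _ fun ω => hF _)
  · have h1 : (fun ω => F (T (n + 1 + 1) ω)) =ᵐ[μ]
        fun ω => F (T (n + 1) ω ∪ children d (V (n + 1) ω)) := by
      filter_upwards [hT.step (n + 1) (by omega)] with ω hω
      rw [hω]
    refine EventuallyEq.symm ((condExp_congr_ae h1).trans
      ((hT.condExp_history (n := n + 1) (by omega) (K := fun t w => F (t ∪ children d w))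
        fun t w => hF _).trans ?_))
    filter_upwards [hT.ae_isGrowth] with ω hω
    have hreg := hω.isRegularTree hd (n := n + 1) (by omega)
    have : ((leaves (T (n + 1) ω)).card : ℝ) ≠ 0 := by
      rw [hreg.card_leaves]
      have : (2 : ℝ) ≤ d := by exact_mod_cast hd
      have : 0 ≤ ((d : ℝ) - 1) * (inner (T (n + 1) ω)).card :=
        mul_nonneg (by linarith) (Nat.cast_nonneg _)
      linarith
    rw [leafMean, hharm _ hreg, mul_div_cancel_left₀ _ this]

lemma IsRegularUA.ae_tendsto [IsProbabilityMeasure μ] (hT : IsRegularUA μ d T V) (hd : 2 ≤ d) {F : Finset Word → ℝ}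
    {C : ℝ} (hF : ∀ t, |F t| ≤ C) (hharm : ∀ t, IsRegularTree d t →
      ∑ w ∈ leaves t, F (t ∪ children d w) = (leaves t).card * F t) :
    ∀ᵐ ω ∂μ, ∃ c, Tendsto (fun n => F (T n ω)) atTop (𝓝 c) := by
  have hC : 0 ≤ C := (abs_nonneg _).trans (hF ∅)
  have hb : ∀ n, eLpNorm (fun ω => F (T (n + 1) ω)) 1 μ ≤ (C.toNNReal : ENNReal) := by
    intro n
    refine (eLpNorm_le_of_ae_bound (C := C) (ae_of_all _ fun ω => hF _)).trans ?_
    simp [ENNReal.ofReal]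
  filter_upwards [(hT.martingale hd hF hharm).submartingale.exists_ae_tendsto_of_bdd hb]
    with ω ⟨c, hc⟩
  exact ⟨c, (tendsto_add_atTop_iff_nat 1).1 hc⟩

lemma IsRegularUA.integral_eq [IsProbabilityMeasure μ] (hT : IsRegularUA μ d T V) (hd : 2 ≤ d) {F : Finset Word → ℝ}
    {C : ℝ} (hF : ∀ t, |F t| ≤ C) (hharm : ∀ t, IsRegularTree d t →
      ∑ w ∈ leaves t, F (t ∪ children d w) = (leaves t).card * F t) {n : ℕ} (hn : 1 ≤ n) :
    ∫ ω, F (T n ω) ∂μ = F (insert [] (children (d + 1) [])) := by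
  have h := (hT.martingale hd hF hharm).setIntegral_eq (Nat.zero_le (n - 1)) MeasurableSet.univ
  rw [setIntegral_univ, setIntegral_univ, Nat.sub_add_cancel hn] at h
  rw [← h, zero_add, integral_congr_ae (g := fun _ => F (insert [] (children (d + 1) [])))]
  · simp
  · filter_upwards [hT.init] with ω hω
    rw [hω]

end

/-! ### Indefinite growth of all subtrees -/

lemma append_mem_regularWords {d : ℕ} {u : Word} {j : ℕ+} :
    u ++ [j] ∈ regularWords d ↔ u ∈ regularWords d ∧ (j : ℕ) ≤ arity d u := by
  cases u with
  | nil => simp [regularWords, arity]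
  | cons x u =>
    simp only [regularWords, arity, Set.mem_ofPred_eq, List.cons_append, List.head?_cons,
      List.tail_cons, List.mem_append, List.mem_singleton, or_imp, forall_and, forall_eq,
      reduceCtorEq, if_false, and_assoc]

lemma IsRegularTree.mem_regularWords {d : ℕ} {t : Finset Word} (ht : IsRegularTree d t) {v : Word}
    (hv : v ∈ t) : v ∈ regularWords d := by
  induction v using List.reverseRecOn with
  | nil => simp [regularWords]
  | append_singleton u j ih =>
    have h := (ht.mem_iff _ _).1 hv
    exact append_mem_regularWords.2 ⟨ih (mem_inner.1 h.1).1, h.2⟩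

lemma IsRegularTree.mem_inner_of_card_pos {d : ℕ} {t : Finset Word} (ht : IsRegularTree d t)
    {u : Word} (h : 0 < (innerBelow t u).card) : u ∈ inner t := by
  obtain ⟨w, hw⟩ := Finset.card_pos.1 h
  obtain ⟨hw1, x, rfl⟩ := Finset.mem_filter.1 hw
  rcases x with _ | ⟨j, x⟩
  · simpa using hw1
  · have hp : u ++ [j] <+: u ++ j :: x := ⟨x, by simp⟩
    exact ((ht.mem_iff u j).1 (ht.mem_of_prefix (mem_inner.1 hw1).1 hp)).1

lemma IsGrowth.tendsto_card_innerBelow {d : ℕ} (hd : 2 ≤ d) {t : ℕ → Finset Word}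
    {v : ℕ → Word} (h : IsGrowth d t v) {u : Word} (hu : ∃ᶠ n in atTop,
      (innerBelow (t n) u).card < (innerBelow (t (n + 1)) u).card) :
    Tendsto (fun n => (innerBelow (t n) u).card) atTop atTop := by
  -- The shift is needed because `t 0` is arbitrary.
  have hmono : Monotone fun n => (innerBelow (t (n + 1)) u).card := by
    refine monotone_nat_of_le_succ fun n => ?_
    rw [h.card_innerBelow_succ hd (n := n + 1) (by omega)]
    exact Nat.le_add_right _ _
  refine (tendsto_add_atTop_iff_nat 1).1 (tendsto_atTop_atTop_of_monotone hmono fun b => ?_)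
  induction b with
  | zero => exact ⟨0, Nat.zero_le _⟩
  | succ b ih =>
    obtain ⟨n, hn⟩ := ih
    obtain ⟨m, hm, hm'⟩ := (frequently_atTop.1 hu) (n + 1)
    obtain ⟨k, rfl⟩ : ∃ k, m = k + 1 := ⟨m - 1, by omega⟩
    have := hmono (show n ≤ k by omega)
    simp only at this hn
    exact ⟨k + 1, by omega⟩

/-- At least one of the `2 + (d - 1) (n + 1) ≤ (d + 1) (n + 1)` leaves is at or below `u`. The bound
is a multiple of the harmonic series, hence not summable. -/
lemma IsGrowth.leafMean_prefix_ge {d : ℕ} (hd : 2 ≤ d) {t : ℕ → Finset Word}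
    {v : ℕ → Word} (h : IsGrowth d t v) {n : ℕ} {u : Word} (hu : u ∈ t (n + 1)) :
    1 / ((d : ℝ) + 1) * (1 / ((n : ℝ) + 1)) ≤
      leafMean (fun _ w => if u <+: w then 1 else 0) (t (n + 1)) := by
  have hreg := h.isRegularTree hd (n := n + 1) (by omega)
  have hd' : (2 : ℝ) ≤ d := by exact_mod_cast hd
  have hcard : ((leaves (t (n + 1))).card : ℝ) = 2 + (d - 1) * (n + 1) := by
    have := h.card_inner hd (n := n + 1) (by omega)
    rw [hreg.card_leaves]
    rw [innerBelow, Finset.filter_true_of_mem fun _ _ => List.nil_prefix] at this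
    rw [this]
    push_cast
    ring
  have hpos : 1 ≤ ((leavesBelow (t (n + 1)) u).card : ℝ) := by
    have h1 := card_leavesBelow_add (t (n + 1)) u
    rw [hreg.card_subtree hu] at h1
    have : 1 ≤ (leavesBelow (t (n + 1)) u).card := by
      have : (innerBelow (t (n + 1)) u).card ≤ d * (innerBelow (t (n + 1)) u).card :=
        Nat.le_mul_of_pos_left _ (by omega)
      omega
    exact_mod_cast this
  have hsum : ∑ w ∈ leaves (t (n + 1)), (if u <+: w then (1 : ℝ) else 0) =
      (leavesBelow (t (n + 1)) u).card := by
    rw [Finset.sum_boole, leavesBelow]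
  rw [leafMean, hsum, hcard, div_mul_div_comm, one_mul]
  have hn : (0 : ℝ) ≤ n := Nat.cast_nonneg n
  gcongr
  · nlinarith
  · nlinarith

section

variable {Ω : Type*} [MeasurableSpace Ω] {μ : Measure Ω} [IsProbabilityMeasure μ] {d : ℕ}
  {T : ℕ → Ω → Finset Word} {V : ℕ → Ω → Word}

lemma IsRegularUA.ae_frequently_of_eventually_mem (hT : IsRegularUA μ d T V) (hd : 2 ≤ d)
    (u : Word) : ∀ᵐ ω ∂μ, (∀ᶠ n in atTop, u ∈ T n ω) →
      ∃ᶠ n in atTop, (innerBelow (T n ω) u).card < (innerBelow (T (n + 1) ω) u).card := by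
  -- The alternative `n = 0` makes `s 0` the whole space: nothing is known about `T 0`, not even its
  -- measurability.
  let s : ℕ → Set Ω := fun n =>
    {ω | n = 0 ∨ (innerBelow (T n ω) u).card < (innerBelow (T (n + 1) ω) u).card}
  have hs : ∀ n, MeasurableSet[hT.filtration n] (s n) := by
    intro n
    rcases Nat.eq_zero_or_pos n with rfl | hn
    · simp [s]
    · have h1 := hT.measurable_filtration (n := n) hn (by omega) fun t => (innerBelow t u).card
      have h2 := hT.measurable_filtration (m := n + 1) (n := n) (by omega) le_rfl
        fun t => (innerBelow t u).card
      have : s n = {ω | (innerBelow (T n ω) u).card < (innerBelow (T (n + 1) ω) u).card} := by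
        ext ω
        simp [s, hn.ne']
      rw [this]
      exact @measurableSet_lt _ _ _ _ _ (hT.filtration n) _ _ _ _ _ h1 h2
  have hcond : ∀ n, μ[(s (n + 1)).indicator (1 : Ω → ℝ) | hT.filtration n] =ᵐ[μ]
      fun ω => leafMean (fun _ w => if u <+: w then 1 else 0) (T (n + 1) ω) := by
    intro n
    have h1 : (s (n + 1)).indicator (1 : Ω → ℝ) =ᵐ[μ]
        fun ω => if u <+: V (n + 1) ω then 1 else 0 := by
      filter_upwards [hT.ae_isGrowth] with ω hω
      have hcard : (innerBelow (T (n + 1 + 1) ω) u).card = _ :=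
        hω.card_innerBelow_succ hd (n := n + 1) (by omega) u
      by_cases hu : u <+: V (n + 1) ω
      · rw [if_pos hu, Set.indicator_of_mem]
        · rfl
        · right
          rw [hcard, if_pos hu]
          exact Nat.lt_succ_self _
      · rw [if_neg hu, Set.indicator_of_notMem]
        rintro (h | h)
        · omega
        · rw [hcard, if_neg hu] at h
          exact lt_irrefl _ h
    exact (condExp_congr_ae h1).trans (hT.condExp_history (n := n + 1) (by omega)
      (K := fun _ w => if u <+: w then 1 else 0) (C := 1) fun t w => by split_ifs <;> simp)
  -- Lévy's conditional Borel–Cantelli lemma: the events occur infinitely often as soon as their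
  -- conditional probabilities have a divergent sum.
  filter_upwards [ae_mem_limsup_atTop_iff μ hs, ae_all_iff.2 hcond, hT.ae_isGrowth]
    with ω h1 h2 hω hmem
  have hdiv : Tendsto (fun n => ∑ k ∈ Finset.range n,
      (μ[(s (k + 1)).indicator (1 : Ω → ℝ) | hT.filtration k]) ω) atTop atTop := by
    obtain ⟨N, hN⟩ := eventually_atTop.1 hmem
    have hd' : (0 : ℝ) < 1 / (d + 1) := by positivity
    have hlow := tendsto_atTop_add_const_right atTop
      (-∑ k ∈ Finset.range N, 1 / ((d : ℝ) + 1) * (1 / ((k : ℝ) + 1)))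
      (Real.tendsto_sum_range_one_div_nat_succ_atTop.const_mul_atTop hd')
    refine tendsto_atTop_mono' _ ?_ hlow
    filter_upwards [eventually_ge_atTop N] with n hn
    simp_rw [h2]
    rw [Finset.mul_sum, ← Finset.sum_range_add_sum_Ico _ hn, ← Finset.sum_range_add_sum_Ico _ hn,
      add_comm, neg_add_cancel_left]
    refine le_add_of_nonneg_of_le (Finset.sum_nonneg fun k _ => ?_) (Finset.sum_le_sum fun k hk => ?_)
    · exact div_nonneg (Finset.sum_nonneg fun w _ => by dsimp only; split_ifs <;> simp) (Nat.cast_nonneg _)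
    · exact hω.leafMean_prefix_ge hd (hN _ (by have := (Finset.mem_Ico.1 hk).1; omega))
  have hfreq := mem_limsup_iff_frequently_mem.1 (h1.2 hdiv)
  refine (hfreq.and_eventually (eventually_gt_atTop 0)).mono fun n hn => ?_
  exact hn.1.resolve_left hn.2.ne'

/-- Almost surely, the subtrees stemming from all the words of the regular tree grow
indefinitely. -/
lemma IsRegularUA.ae_tendsto_card_innerBelow (hT : IsRegularUA μ d T V) (hd : 2 ≤ d) :
    ∀ᵐ ω ∂μ, ∀ u ∈ regularWords d,
      Tendsto (fun n => (innerBelow (T n ω) u).card) atTop atTop := by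
  filter_upwards [ae_all_iff.2 (hT.ae_frequently_of_eventually_mem hd), hT.ae_isGrowth]
    with ω h hω u hu
  induction u using List.reverseRecOn with
  | nil =>
    refine tendsto_id.congr' ?_
    filter_upwards [eventually_ge_atTop 1] with n hn
    exact (hω.card_inner hd hn).symm
  | append_singleton u j ih =>
    obtain ⟨hu1, hu2⟩ := append_mem_regularWords.1 hu
    refine hω.tendsto_card_innerBelow hd (h _ ?_)
    filter_upwards [(ih hu1).eventually_gt_atTop 0, eventually_ge_atTop 1] with n hn hn1
    have hreg := hω.isRegularTree hd hn1
    exact (hreg.mem_iff _ _).2 ⟨hreg.mem_inner_of_card_pos hn, hu2⟩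

/-! ### Limits of the proportions and their joint moments -/

lemma urn_nonneg {d : ℕ} (hd : 2 ≤ d) (t : Finset Word) (u : Word) (a : ℕ → ℕ) :
    0 ≤ urn d t u a := polya_nonneg (fun _ => weight_pos hd _ _) a

lemma urn_le_one {d : ℕ} (hd : 2 ≤ d) (t : Finset Word) (u : Word) (a : ℕ → ℕ) :
    urn d t u a ≤ 1 := polya_le_one (fun _ => weight_pos hd _ _) a

lemma abs_prod_urn_le {d : ℕ} (hd : 2 ≤ d) (S : Finset Word) (a : Word → ℕ → ℕ)
    (t : Finset Word) : |∏ u ∈ S, urn d t u (a u)| ≤ 1 := by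
  rw [abs_of_nonneg (Finset.prod_nonneg fun u _ => urn_nonneg hd t u _)]
  exact Finset.prod_le_one (fun u _ => urn_nonneg hd t u _) fun u _ => urn_le_one hd t u _

lemma urn_init (d : ℕ) (u : Word) (a : ℕ → ℕ) :
    urn d (insert [] (children (d + 1) [])) u a =
      polya (arity d u) (fun _ => 1 / ((d : ℝ) - 1)) a := by
  refine polya_congr (fun i _ => ?_) a
  have : innerBelow (insert [] (children (d + 1) [])) (child u i) = ∅ := by
    rw [innerBelow, inner_init]
    exact Finset.filter_false_of_mem fun w hw => by simp [Finset.mem_singleton.1 hw, child]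
  rw [weight, this]
  simp

lemma polya_single {k : ℕ} (y : ℕ → ℝ) {i : ℕ} (hi : i < k) :
    polya k y (Pi.single i 1) = y i / ∑ j ∈ Finset.range k, y j := by
  have hi' : i ∈ Finset.range k := Finset.mem_range.2 hi
  have h1 : ∑ j ∈ Finset.range k, (Pi.single i 1 : ℕ → ℕ) j = 1 := by
    rw [Finset.sum_eq_single_of_mem i hi' fun j _ hj => Pi.single_eq_of_ne hj _, Pi.single_eq_same]
  have h2 : ∏ j ∈ Finset.range k, rise (y j) ((Pi.single i 1 : ℕ → ℕ) j) = y i := by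
    rw [Finset.prod_eq_single_of_mem i hi' fun j _ hj => by
      rw [Pi.single_eq_of_ne hj, rise_zero], Pi.single_eq_same]
    simp [rise]
  rw [polya, h1, h2]
  simp [rise]

lemma tendsto_rise_div {y s : ℕ → ℝ} {x : ℝ} (hs : Tendsto s atTop atTop)
    (hy : Tendsto (fun n => y n / s n) atTop (𝓝 x)) (a : ℕ) :
    Tendsto (fun n => rise (y n) a / s n ^ a) atTop (𝓝 (x ^ a)) := by
  have : ∀ n, rise (y n) a / s n ^ a = ∏ i ∈ Finset.range a, (y n / s n + i / s n) := by
    intro n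
    have : s n ^ a = ∏ _i ∈ Finset.range a, s n := by simp
    rw [rise, this, ← Finset.prod_div_distrib]
    exact Finset.prod_congr rfl fun i _ => add_div _ _ _
  simp_rw [this]
  have h := tendsto_finsetProd (Finset.range a) fun i _ =>
    hy.add (tendsto_const_nhds (x := (i : ℝ)).div_atTop hs)
  simpa using h

/-- Divide numerator and denominator by the total weight to the power `∑ a i`. The bounded shifts in
the rising factorials disappear in the limit, leaving ordinary powers. -/
lemma tendsto_polya {k : ℕ} {y : ℕ → ℕ → ℝ} {x : ℕ → ℝ}
    (hs : Tendsto (fun n => ∑ i ∈ Finset.range k, y n i) atTop atTop)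
    (hy : ∀ i < k, Tendsto (fun n => y n i / ∑ j ∈ Finset.range k, y n j) atTop (𝓝 (x i)))
    (a : ℕ → ℕ) :
    Tendsto (fun n => polya k (y n) a) atTop (𝓝 (∏ i ∈ Finset.range k, x i ^ a i)) := by
  have hne : ∀ᶠ n in atTop, ∑ i ∈ Finset.range k, y n i ≠ 0 := hs.eventually_ne_atTop 0
  have h1 := tendsto_finsetProd (Finset.range k) fun i hi =>
    tendsto_rise_div hs (hy i (Finset.mem_range.1 hi)) (a i)
  have h2 := tendsto_rise_div hs ((tendsto_const_nhds (x := (1 : ℝ))).congr'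
    (hne.mono fun n hn => (div_self hn).symm)) (∑ i ∈ Finset.range k, a i)
  have h3 := h1.div h2 (by simp)
  rw [one_pow, div_one] at h3
  refine h3.congr' ?_
  filter_upwards [hne] with n hn
  simp only [Pi.div_apply]
  rw [Finset.prod_div_distrib, Finset.prod_pow_eq_pow_sum, polya]
  exact div_div_div_cancel_right₀ (pow_ne_zero _ hn) _ _

/-- The proportions of sizes and of weights are asymptotically the same. -/
lemma IsRegularTree.ratio_child {d : ℕ} (hd : 2 ≤ d) {t : Finset Word} (ht : IsRegularTree d t)
    {u : Word} (hu : u ∈ inner t) {i : ℕ} (hi : i < arity d u) :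
    ratio (child u i) t = (d * weight d t (child u i) - 1 / ((d : ℝ) - 1)) /
      (d * (∑ j ∈ Finset.range (arity d u), weight d t (child u j)) -
        (1 + if u = [] then 1 else 0) / ((d : ℝ) - 1)) := by
  have hmem := ht.child_mem_iff.2 ⟨hu, hi⟩
  have h0 : child u i ≠ [] := by simp [child]
  have hdrop : (child u i).dropLast = u := by simp [child]
  have : (2 : ℝ) ≤ d := by exact_mod_cast hd
  have : (d : ℝ) - 1 ≠ 0 := by linarith
  rw [ratio, if_pos hmem, hdrop, ht.card_subtree hmem, ht.card_subtree (mem_inner.1 hu).1,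
    ht.sum_weight_child hd hu, weight, if_neg h0]
  push_cast
  congr 1 <;> field_simp <;> ring

end

/-- The proportion of the weight below `u` which is below `child u i`, in the limit. -/
lemma tendsto_ratio_child {d : ℕ} (hd : 2 ≤ d) {t : ℕ → Finset Word} {v : ℕ → Word}
    (h : IsGrowth d t v) {u : Word}
    (hu : Tendsto (fun n => (innerBelow (t n) u).card) atTop atTop) :
    Tendsto (fun n => ∑ j ∈ Finset.range (arity d u), weight d (t n) (child u j)) atTop atTop ∧
    ∀ i < arity d u, ∀ x : ℝ,
      Tendsto (fun n => weight d (t n) (child u i) /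
        ∑ j ∈ Finset.range (arity d u), weight d (t n) (child u j)) atTop (𝓝 x) →
      Tendsto (fun n => ratio (child u i) (t n)) atTop (𝓝 x) := by
  have hinner : ∀ᶠ n in atTop, IsRegularTree d (t n) ∧ u ∈ inner (t n) := by
    filter_upwards [hu.eventually_gt_atTop 0, eventually_ge_atTop 1] with n hn hn1
    exact ⟨h.isRegularTree hd hn1, (h.isRegularTree hd hn1).mem_inner_of_card_pos hn⟩
  have hs : Tendsto (fun n => ∑ j ∈ Finset.range (arity d u), weight d (t n) (child u j))
      atTop atTop := by
    refine (tendsto_atTop_add_const_left atTop ((1 + if u = [] then 1 else 0) / ((d : ℝ) - 1))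
      (tendsto_natCast_atTop_atTop.comp hu)).congr' ?_
    filter_upwards [hinner] with n hn
    exact (hn.1.sum_weight_child hd hn.2).symm
  refine ⟨hs, fun i hi x hx => ?_⟩
  have hd0 : (d : ℝ) ≠ 0 := by
    have : (2 : ℝ) ≤ d := by exact_mod_cast hd
    linarith
  have h1 := (hx.const_mul (d : ℝ)).sub
    (tendsto_const_nhds (x := 1 / ((d : ℝ) - 1)).div_atTop hs)
  have h2 := (tendsto_const_nhds (x := (d : ℝ))).sub
    (tendsto_const_nhds (x := (1 + if u = [] then 1 else 0) / ((d : ℝ) - 1)).div_atTop hs)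
  -- Sizes are affine in weights with slope `d`: after division by the total weight the constants
  -- vanish and the two factors `d` cancel.
  have h3 := h1.div h2 (by simpa using hd0)
  rw [sub_zero, sub_zero, mul_div_cancel_left₀ _ hd0] at h3
  refine h3.congr' ?_
  filter_upwards [hinner, hs.eventually_ne_atTop 0] with n hn hn0
  rw [hn.1.ratio_child hd hn.2 hi]
  simp only [Pi.div_apply]
  set s := ∑ j ∈ Finset.range (arity d u), weight d (t n) (child u j)
  rw [← mul_div_assoc, ← sub_div, ← div_div_div_cancel_right₀ hn0 _ (d * s - _), sub_div (d * s),
    mul_div_cancel_right₀ _ hn0]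

section

variable {Ω : Type*} [MeasurableSpace Ω] {μ : Measure Ω} [IsProbabilityMeasure μ] {d : ℕ}
  {T : ℕ → Ω → Finset Word} {V : ℕ → Ω → Word}

/-- Almost surely, all the proportions of weights converge, to the limiting proportions of
sizes. -/
lemma IsRegularUA.ae_tendsto_weight (hT : IsRegularUA μ d T V) (hd : 2 ≤ d) :
    ∀ᵐ ω ∂μ, ∀ u ∈ regularWords d, ∀ i < arity d u,
      Tendsto (fun n => weight d (T n ω) (child u i) /
        ∑ j ∈ Finset.range (arity d u), weight d (T n ω) (child u j)) atTop
          (𝓝 (limitRatio T (child u i) ω)) ∧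
      Tendsto (fun n => ratio (child u i) (T n ω)) atTop (𝓝 (limitRatio T (child u i) ω)) := by
  -- For `i < arity d u`, the exponent `Pi.single i 1` means one draw of colour `i`, and the
  -- martingale is the proportion of weight below child `i`.
  have hconv : ∀ᵐ ω ∂μ, ∀ (u : Word) (i : ℕ),
      ∃ c, Tendsto (fun n => urn d (T n ω) u (Pi.single i 1)) atTop (𝓝 c) := by
    refine ae_all_iff.2 fun u => ae_all_iff.2 fun i => ?_
    refine hT.ae_tendsto hd (F := fun t => urn d t u (Pi.single i 1)) (C := 1) (fun t => ?_)
      fun t ht => ?_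
    · rw [abs_of_nonneg (urn_nonneg hd t u _)]
      exact urn_le_one hd t u _
    · simpa using sum_prod_urn_step hd ht (fun _ => Pi.single i 1) {u}
  filter_upwards [hconv, hT.ae_tendsto_card_innerBelow hd, hT.ae_isGrowth] with ω h1 h2 hω u hu i hi
  obtain ⟨c, hc⟩ := h1 u i
  simp_rw [urn, polya_single _ hi] at hc
  have hr := (tendsto_ratio_child hd hω (h2 u hu)).2 i hi c hc
  have : limitRatio T (child u i) ω = c := hr.limUnder_eq
  rw [this]
  exact ⟨hc, hr⟩

lemma IsRegularUA.ae_tendsto_ratio (hT : IsRegularUA μ d T V) (hd : 2 ≤ d) {v : Word}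
    (hv : v ≠ []) :
    ∀ᵐ ω ∂μ, Tendsto (fun n => ratio v (T n ω)) atTop (𝓝 (limitRatio T v ω)) := by
  by_cases hreg : v ∈ regularWords d
  · obtain ⟨u, j, rfl⟩ : ∃ u j, v = u ++ [j] := by
      rcases List.eq_nil_or_concat v with h | ⟨u, j, h⟩
      · exact absurd h hv
      · exact ⟨u, j, by simpa using h⟩
    obtain ⟨hu, hj⟩ := append_mem_regularWords.1 hreg
    filter_upwards [hT.ae_tendsto_weight hd] with ω hω
    have hlt : j.natPred < arity d u := by
      have := j.pos
      rw [PNat.natPred]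
      omega
    simpa [child] using (hω u hu j.natPred hlt).2
  · filter_upwards [hT.ae_isGrowth] with ω hω
    -- A word outside `regularWords d` never enters the tree.
    have h0 : Tendsto (fun n => ratio v (T n ω)) atTop (𝓝 0) := by
      refine tendsto_const_nhds.congr' ?_
      filter_upwards [eventually_ge_atTop 1] with n hn
      rw [ratio, if_neg fun h => hreg ((hω.isRegularTree hd hn).mem_regularWords h)]
    exact tendsto_nhds_limUnder ⟨0, h0⟩

lemma IsRegularUA.aemeasurable_limitRatio (hT : IsRegularUA μ d T V) (hd : 2 ≤ d) {v : Word}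
    (hv : v ≠ []) : AEMeasurable (limitRatio T v) μ := by
  refine aemeasurable_of_tendsto_metrizable_ae atTop (f := fun n ω => ratio v (T (n + 1) ω))
    (fun n => ?_) ?_
  · exact ((Measurable.of_discrete (f := ratio v)).comp
      (hT.measurable_T (n := n + 1) (by omega))).aemeasurable
  · filter_upwards [hT.ae_tendsto_ratio hd hv] with ω hω
    exact (tendsto_add_atTop_iff_nat 1).2 hω

lemma ratio_mem_Icc (v : Word) (t : Finset Word) : ratio v t ∈ Set.Icc (0 : ℝ) 1 := by
  rw [ratio]
  split_ifs
  · refine ⟨by positivity, div_le_one_of_le₀ ?_ (Nat.cast_nonneg _)⟩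
    rw [card_subtree, card_subtree, Nat.cast_le]
    exact Finset.card_le_card (Finset.monotone_filter_right _ fun w _ h =>
      (List.dropLast_prefix v).trans h)
  · simp

lemma IsRegularUA.ae_limitRatio_mem_Icc (hT : IsRegularUA μ d T V) (hd : 2 ≤ d) {v : Word}
    (hv : v ≠ []) : ∀ᵐ ω ∂μ, limitRatio T v ω ∈ Set.Icc (0 : ℝ) 1 := by
  filter_upwards [hT.ae_tendsto_ratio hd hv] with ω hω
  exact isClosed_Icc.mem_of_tendsto hω (Eventually.of_forall fun n => ratio_mem_Icc v _)

/-- The joint moments of the limiting proportions. -/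
lemma IsRegularUA.integral_prod_limitRatio (hT : IsRegularUA μ d T V) (hd : 2 ≤ d)
    {S : Finset Word} (hS : ∀ u ∈ S, u ∈ regularWords d) (a : Word → ℕ → ℕ) :
    ∫ ω, ∏ u ∈ S, ∏ i ∈ Finset.range (arity d u), limitRatio T (child u i) ω ^ a u i ∂μ =
      ∏ u ∈ S, polya (arity d u) (fun _ => 1 / ((d : ℝ) - 1)) (a u) := by
  have hlim : ∀ᵐ ω ∂μ, Tendsto (fun n => ∏ u ∈ S, urn d (T (n + 1) ω) u (a u)) atTop
      (𝓝 (∏ u ∈ S, ∏ i ∈ Finset.range (arity d u), limitRatio T (child u i) ω ^ a u i)) := by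
    filter_upwards [hT.ae_tendsto_weight hd, hT.ae_tendsto_card_innerBelow hd, hT.ae_isGrowth]
      with ω h1 h2 hω
    refine (tendsto_add_atTop_iff_nat (f := fun n => ∏ u ∈ S, urn d (T n ω) u (a u)) 1).2
      (tendsto_finsetProd _ fun u hu => ?_)
    exact tendsto_polya (tendsto_ratio_child hd hω (h2 u (hS u hu))).1
      (fun i hi => (h1 u (hS u hu) i hi).1) (a u)
  have h := tendsto_integral_of_dominated_convergence (fun _ => (1 : ℝ))
    (fun n => ((Measurable.of_discrete (f := fun t => ∏ u ∈ S, urn d t u (a u))).comp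
      (hT.measurable_T (n := n + 1) (by omega))).aestronglyMeasurable)
    (integrable_const _) (fun n => ae_of_all μ fun ω => abs_prod_urn_le hd S a _) hlim
  -- The martingale keeps its initial mean, and in the initial tree no child has an inner vertex
  -- below it, so all urns have weights `1 / (d - 1)`.
  have hconst : ∀ n, ∫ ω, ∏ u ∈ S, urn d (T (n + 1) ω) u (a u) ∂μ =
      ∏ u ∈ S, polya (arity d u) (fun _ => 1 / ((d : ℝ) - 1)) (a u) := by
    intro n
    rw [hT.integral_eq hd (F := fun t => ∏ u ∈ S, urn d t u (a u)) (abs_prod_urn_le hd S a)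
      (fun t ht => sum_prod_urn_step hd ht a S) (n := n + 1) (by omega)]
    exact Finset.prod_congr rfl fun u _ => urn_init d u _
  refine tendsto_nhds_unique h ?_
  simp only [Function.comp_apply, hconst]
  exact tendsto_const_nhds

end

/-! ### Dirichlet integrals and Dirichlet moments -/

/-- The function `x ^ (a - 1)` on the positive reals, extended by zero. -/
noncomputable def powPos (a x : ℝ) : ENNReal :=
  if 0 < x then ENNReal.ofReal (x ^ (a - 1)) else 0

@[fun_prop]
lemma measurable_powPos (a : ℝ) : Measurable (powPos a) :=
  Measurable.ite measurableSet_Ioi (by fun_prop) measurable_const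

/-- The substitution `x = r z` turns the convolution into the Beta integral; for `r ≤ 0` both sides
vanish. -/
lemma lintegral_powPos_mul {a b : ℝ} (ha : 0 < a) (hb : 0 < b) (r : ℝ) :
    ∫⁻ x, powPos a x * powPos b (r - x) = ENNReal.ofReal (beta a b) * powPos (a + b) r := by
  rcases le_or_gt r 0 with hr | hr
  · have : ∀ x, powPos a x * powPos b (r - x) = 0 := by
      intro x
      rcases le_or_gt x 0 with hx | hx
      · rw [powPos, if_neg hx.not_gt, zero_mul]
      · rw [powPos, powPos, if_neg (by linarith : ¬ 0 < r - x), mul_zero]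
    simp only [this, lintegral_zero]
    rw [powPos, if_neg hr.not_gt, mul_zero]
  · have hβ := beta_pos ha hb
    have hscale : ∀ z, powPos a (r * z) * powPos b (r - r * z) =
        ENNReal.ofReal (r ^ (a + b - 2) * beta a b) * betaPDF a b z := by
      intro z
      have hrz : r - r * z = r * (1 - z) := by ring
      rw [hrz, betaPDF_eq]
      by_cases hz : 0 < z ∧ z < 1
      · have hz1 : 0 < 1 - z := by linarith [hz.2]
        rw [if_pos hz, powPos, powPos, if_pos (mul_pos hr hz.1), if_pos (mul_pos hr hz1),
          ← ENNReal.ofReal_mul (by have := hz.1; positivity),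
          ← ENNReal.ofReal_mul (by positivity), Real.mul_rpow hr.le hz.1.le,
          Real.mul_rpow hr.le hz1.le, show a + b - 2 = (a - 1) + (b - 1) by ring,
          Real.rpow_add hr]
        congr 1
        field_simp
      · rw [if_neg hz, ENNReal.ofReal_zero, mul_zero]
        by_cases hz0 : 0 < z
        · have : ¬ 0 < r * (1 - z) := by
            have : 1 - z ≤ 0 := by
              have := not_and.1 hz hz0
              linarith
            exact not_lt.2 (mul_nonpos_of_nonneg_of_nonpos hr.le this)
          rw [powPos, powPos, if_neg this, mul_zero]
        · have : ¬ 0 < r * z :=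
            not_lt.2 (mul_nonpos_of_nonneg_of_nonpos hr.le (not_lt.1 hz0))
          rw [powPos, if_neg this, zero_mul]
    have hpdf : Measurable (betaPDF a b) := (measurable_betaPDFReal a b).ennreal_ofReal
    rw [← Real.smul_map_volume_mul_left hr.ne', lintegral_smul_measure,
      lintegral_map (by fun_prop) (by fun_prop)]
    simp_rw [hscale]
    rw [lintegral_const_mul _ hpdf, lintegral_betaPDF_eq_one ha hb, mul_one, abs_of_pos hr, powPos,
      if_pos hr, smul_eq_mul, ← ENNReal.ofReal_mul hr.le, ← ENNReal.ofReal_mul hβ.le,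
      show a + b - 1 = (a + b - 2) + 1 by ring, Real.rpow_add hr, Real.rpow_one]
    congr 1
    ring

/-- Fixing the first coordinate `y` leaves the same integral in one dimension less with `r - y` for
`r`, which is why `r` is arbitrary. The integral over `y` is then a Beta convolution. -/
lemma lintegral_prod_powPos (m : ℕ) (α : Fin m → ℝ) (hα : ∀ i, 0 < α i) {b : ℝ} (hb : 0 < b)
    (r : ℝ) :
    ∫⁻ x : Fin m → ℝ, (∏ i, powPos (α i) (x i)) * powPos b (r - ∑ i, x i) =
      ENNReal.ofReal ((∏ i, Real.Gamma (α i)) * Real.Gamma b / Real.Gamma (∑ i, α i + b)) *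
        powPos (∑ i, α i + b) r := by
  induction m generalizing r with
  | zero =>
    have : Real.Gamma b ≠ 0 := (Real.Gamma_pos_of_pos hb).ne'
    simp [this, volume_pi]
  | succ m ih =>
    have hpos : 0 < ∑ i : Fin m, α i.succ + b :=
      add_pos_of_nonneg_of_pos (Finset.sum_nonneg fun i _ => (hα _).le) hb
    have hG := Real.Gamma_pos_of_pos hpos
    have e := (volume_preserving_piFinSuccAbove (fun _ : Fin (m + 1) => ℝ) 0).symm
    rw [← e.lintegral_comp_emb (MeasurableEquiv.measurableEmbedding _), Measure.volume_eq_prod,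
      lintegral_prod _ (by fun_prop)]
    have h : ∀ y : ℝ, ∫⁻ x : Fin m → ℝ, (∏ i, powPos (α i)
          ((MeasurableEquiv.piFinSuccAbove (fun _ : Fin (m + 1) => ℝ) 0).symm (y, x) i)) *
        powPos b (r - ∑ i, (MeasurableEquiv.piFinSuccAbove (fun _ : Fin (m + 1) => ℝ) 0).symm
          (y, x) i) =
        ENNReal.ofReal ((∏ i : Fin m, Real.Gamma (α i.succ)) * Real.Gamma b /
          Real.Gamma (∑ i : Fin m, α i.succ + b)) *
          (powPos (α 0) y * powPos (∑ i : Fin m, α i.succ + b) (r - y)) := by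
      intro y
      simp only [MeasurableEquiv.piFinSuccAbove_symm_apply, Fin.insertNthEquiv_zero,
        Fin.prod_univ_succ, Fin.sum_univ_succ, Fin.consEquiv_apply, Fin.cons_zero, Fin.cons_succ,
        mul_assoc, ← sub_sub]
      rw [lintegral_const_mul _ (by fun_prop), ih _ (fun i => hα _)]
      ring
    simp_rw [h]
    rw [lintegral_const_mul _ (by fun_prop), lintegral_powPos_mul (hα 0) hpos, ← mul_assoc,
      ← ENNReal.ofReal_mul (by
        have := Real.Gamma_pos_of_pos hb
        have : 0 ≤ ∏ i : Fin m, Real.Gamma (α i.succ) :=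
          Finset.prod_nonneg fun i _ => (Real.Gamma_pos_of_pos (hα _)).le
        positivity), Fin.sum_univ_succ, Fin.prod_univ_succ, add_assoc, beta]
    congr 2
    field_simp

/-- The parametrization `simplexPoint` of the simplex in dimension `m`. -/
noncomputable def simplexMap (m : ℕ) (x : Fin m → ℝ) : Fin (m + 1) → ℝ := simplexPoint (m + 1) x

lemma simplexMap_castSucc {m : ℕ} (x : Fin m → ℝ) (i : Fin m) :
    simplexMap m x i.castSucc = x i := by
  simp [simplexMap, simplexPoint]

lemma simplexMap_last {m : ℕ} (x : Fin m → ℝ) :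
    simplexMap m x (Fin.last m) = 1 - ∑ i, x i := by
  simp [simplexMap, simplexPoint]

lemma sum_simplexMap {m : ℕ} (x : Fin m → ℝ) : ∑ i, simplexMap m x i = 1 := by
  rw [Fin.sum_univ_castSucc]
  simp [simplexMap_castSucc, simplexMap_last]

lemma measurable_simplexMap (m : ℕ) : Measurable (simplexMap m) := by
  refine measurable_pi_lambda _ fun i => ?_
  induction i using Fin.lastCases with
  | last => simp_rw [simplexMap_last]; fun_prop
  | cast i => simp_rw [simplexMap_castSucc]; fun_prop

lemma lintegral_simplexMap_powPos {m : ℕ} {α : Fin (m + 1) → ℝ} (hα : ∀ i, 0 < α i) :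
    ∫⁻ x : Fin m → ℝ, ∏ i, powPos (α i) (simplexMap m x i) =
      ENNReal.ofReal ((∏ i, Real.Gamma (α i)) / Real.Gamma (∑ i, α i)) := by
  have h := lintegral_prod_powPos m (fun i => α i.castSucc) (fun i => hα _) (hα (Fin.last m)) 1
  simp only [Fin.prod_univ_castSucc, simplexMap_castSucc, simplexMap_last, Fin.sum_univ_castSucc]
  rw [h, powPos, if_pos one_pos, Real.one_rpow, ENNReal.ofReal_one, mul_one]

/-- The faces of the simplex lie in null hyperplanes. They must be discarded because `powPos`
vanishes at `0`, whereas the real power `0 ^ 0` in the density is `1`. -/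
lemma ae_simplexMap_ne_zero {m : ℕ} :
    ∀ᵐ x : Fin m → ℝ, ∀ i, simplexMap m x i ≠ 0 := by
  refine ae_all_iff.2 fun i => ?_
  induction i using Fin.lastCases with
  | last =>
    simp_rw [simplexMap_last]
    let s : AffineSubspace ℝ (Fin m → ℝ) :=
      { carrier := {x | ∑ i, x i = 1}
        smul_vsub_vadd_mem' := by
          intro c x y z hx hy hz
          simp only [Set.mem_ofPred_eq] at hx hy hz ⊢
          simp [Finset.sum_add_distrib, ← Finset.mul_sum, hx, hy, hz] }
    have hs : s ≠ ⊤ := by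
      intro h
      have : (0 : Fin m → ℝ) ∈ s := by rw [h]; trivial
      have h0 : ∑ i, (0 : Fin m → ℝ) i = 1 := this
      simp at h0
    have := Measure.addHaar_affineSubspace (volume : Measure (Fin m → ℝ)) s hs
    filter_upwards [measure_eq_zero_iff_ae_notMem.1 this] with x hx h
    exact hx (by linarith : ∑ i, x i = 1)
  | cast i =>
    simp_rw [simplexMap_castSucc]
    exact measure_eq_zero_iff_ae_notMem.1 (Measure.pi_hyperplane (fun _ => volume) i 0)

lemma dirichlet_eq_map {m : ℕ} (α : Fin (m + 1) → ℝ) : dirichlet α =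
    ((volume : Measure (Fin m → ℝ)).withDensity
      ({x | simplexMap m x ∈ stdSimplex ℝ (Fin (m + 1))}.indicator fun x =>
        ENNReal.ofReal (dirichletDensity α (simplexMap m x)))).map (simplexMap m) :=
  rfl

lemma measurableSet_simplexMap_mem (m : ℕ) :
    MeasurableSet {x : Fin m → ℝ | simplexMap m x ∈ stdSimplex ℝ (Fin (m + 1))} :=
  measurable_simplexMap m (isClosed_stdSimplex ℝ (Fin (m + 1))).measurableSet

lemma measurable_dirichletDensity {m : ℕ} (α : Fin (m + 1) → ℝ) : Measurable fun x : Fin m → ℝ =>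
    ENNReal.ofReal (dirichletDensity α (simplexMap m x)) := by
  have := measurable_simplexMap m
  unfold dirichletDensity
  fun_prop

/-- Multiplying the density by a monomial only shifts the parameters to `α i + a i`, so the moment
is a ratio of normalizing constants. -/
lemma lintegral_dirichlet {m : ℕ} {α : Fin (m + 1) → ℝ} (hα : ∀ i, 0 < α i) (a : Fin (m + 1) → ℕ) :
    ∫⁻ y, ∏ i, ENNReal.ofReal (y i ^ a i) ∂dirichlet α =
      ENNReal.ofReal (Real.Gamma (∑ i, α i) / (∏ i, Real.Gamma (α i)) *
        ((∏ i, Real.Gamma (α i + a i)) / Real.Gamma (∑ i, (α i + a i)))) := by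
  have hc : 0 ≤ Real.Gamma (∑ i, α i) / (∏ i, Real.Gamma (α i)) :=
    div_nonneg (Real.Gamma_nonneg_of_nonneg (Finset.sum_nonneg fun i _ => (hα i).le))
      (Finset.prod_nonneg fun i _ => (Real.Gamma_pos_of_pos (hα i)).le)
  have hmeas' := measurable_simplexMap m
  rw [dirichlet_eq_map, lintegral_map (by fun_prop) hmeas',
    lintegral_withDensity_eq_lintegral_mul _
      ((measurable_dirichletDensity α).indicator (measurableSet_simplexMap_mem m)) (by fun_prop),
    ENNReal.ofReal_mul hc, ← lintegral_simplexMap_powPos fun i =>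
      add_pos_of_pos_of_nonneg (hα i) (Nat.cast_nonneg (a i)),
    ← lintegral_const_mul _ (by fun_prop)]
  refine lintegral_congr_ae ?_
  filter_upwards [ae_simplexMap_ne_zero] with x hx
  rw [Pi.mul_apply]
  by_cases hmem : ∀ i, 0 ≤ simplexMap m x i
  · have hmem' : simplexMap m x ∈ stdSimplex ℝ (Fin (m + 1)) := ⟨hmem, sum_simplexMap x⟩
    have hpos : ∀ i, 0 < simplexMap m x i := fun i => (hmem i).lt_of_ne (hx i).symm
    rw [Set.indicator_of_mem
      (show x ∈ {x | simplexMap m x ∈ stdSimplex ℝ (Fin (m + 1))} from hmem'), dirichletDensity,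
      ENNReal.ofReal_mul hc, mul_assoc,
      ENNReal.ofReal_prod_of_nonneg fun i _ => Real.rpow_nonneg (hmem i) _,
      ← Finset.prod_mul_distrib]
    congr 1
    refine Finset.prod_congr rfl fun i _ => ?_
    rw [powPos, if_pos (hpos i), ← ENNReal.ofReal_mul (Real.rpow_nonneg (hmem i) _),
      ← Real.rpow_natCast, ← Real.rpow_add (hpos i)]
    congr 2
    ring
  · rw [Set.indicator_of_notMem
      (show x ∉ {x | simplexMap m x ∈ stdSimplex ℝ (Fin (m + 1))} from fun h => hmem h.1), zero_mul]
    push Not at hmem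
    obtain ⟨i, hi⟩ := hmem
    have h0 : powPos (α i + a i) (simplexMap m x i) = 0 := if_neg hi.not_gt
    rw [Finset.prod_eq_zero (f := fun i => powPos (α i + a i) (simplexMap m x i))
      (Finset.mem_univ i) h0, mul_zero]

lemma isProbabilityMeasure_dirichlet {m : ℕ} {α : Fin (m + 1) → ℝ} (hα : ∀ i, 0 < α i) :
    IsProbabilityMeasure (dirichlet α) := by
  have h := lintegral_dirichlet hα 0
  have h1 := (Real.Gamma_pos_of_pos (Finset.sum_pos (fun i _ => hα i) Finset.univ_nonempty)).ne'
  have h2 : ∏ i, Real.Gamma (α i) ≠ 0 :=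
    Finset.prod_ne_zero_iff.2 fun i _ => (Real.Gamma_pos_of_pos (hα i)).ne'
  refine ⟨?_⟩
  simpa [div_mul_div_cancel₀, h1, h2] using h

lemma ae_dirichlet_mem_stdSimplex {m : ℕ} (α : Fin (m + 1) → ℝ) :
    ∀ᵐ y ∂dirichlet α, y ∈ stdSimplex ℝ (Fin (m + 1)) := by
  rw [dirichlet_eq_map, ae_map_iff (p := (· ∈ stdSimplex ℝ (Fin (m + 1))))
    (measurable_simplexMap m).aemeasurable (isClosed_stdSimplex ℝ (Fin (m + 1))).measurableSet, ae_withDensity_iff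
      ((measurable_dirichletDensity α).indicator (measurableSet_simplexMap_mem m))]
  refine ae_of_all _ fun x hx => ?_
  by_contra h
  exact hx (Set.indicator_of_notMem
    (show x ∉ {x | simplexMap m x ∈ stdSimplex ℝ (Fin (m + 1))} from h) _)

lemma Gamma_add_nat {x : ℝ} (hx : 0 < x) (n : ℕ) :
    Real.Gamma (x + n) = rise x n * Real.Gamma x := by
  induction n with
  | zero => simp
  | succ n ih =>
    rw [Nat.cast_succ, ← add_assoc, Real.Gamma_add_one (by positivity), ih, rise_succ]
    ring

lemma ae_symmDirichlet_mem_Icc {k : ℕ} (hk : 0 < k) (α : ℝ) :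
    ∀ᵐ y ∂symmDirichlet k α, ∀ i, y i ∈ Set.Icc (0 : ℝ) 1 := by
  obtain ⟨m, rfl⟩ := Nat.exists_eq_add_one.2 hk
  filter_upwards [ae_dirichlet_mem_stdSimplex fun _ : Fin (m + 1) => α] with y hy i
  exact mem_Icc_of_mem_stdSimplex hy i

lemma isProbabilityMeasure_symmDirichlet {k : ℕ} (hk : 0 < k) {α : ℝ} (hα : 0 < α) :
    IsProbabilityMeasure (symmDirichlet k α) := by
  obtain ⟨m, rfl⟩ := Nat.exists_eq_add_one.2 hk
  exact isProbabilityMeasure_dirichlet fun _ => hα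

/-- The moments of the symmetric Dirichlet distribution. -/
lemma integral_symmDirichlet {k : ℕ} (hk : 0 < k) {α : ℝ} (hα : 0 < α) (a : ℕ → ℕ) :
    ∫ y, ∏ i : Fin k, y i ^ a i ∂symmDirichlet k α = polya k (fun _ => α) a := by
  have hae := ae_symmDirichlet_mem_Icc hk α
  obtain ⟨m, rfl⟩ := Nat.exists_eq_add_one.2 hk
  rw [integral_eq_lintegral_of_nonneg_ae
    (hae.mono fun y hy => Finset.prod_nonneg fun i _ => pow_nonneg (hy i).1 _)
    (Measurable.aestronglyMeasurable (by fun_prop)),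
    lintegral_congr_ae (hae.mono fun y hy =>
      ENNReal.ofReal_prod_of_nonneg fun i _ => pow_nonneg (hy i).1 _), symmDirichlet,
    lintegral_dirichlet (fun _ => hα) fun i => a i]
  have hs : 0 < ∑ _i : Fin (m + 1), α := Finset.sum_pos (fun i _ => hα) Finset.univ_nonempty
  have h1 := Real.Gamma_pos_of_pos hs
  have h2 := Real.Gamma_pos_of_pos hα
  have h3 : ∑ i : Fin (m + 1), (α + (a i : ℝ)) =
      ∑ _i : Fin (m + 1), α + ((∑ i : Fin (m + 1), a i : ℕ) : ℝ) := by
    push_cast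
    rw [Finset.sum_add_distrib]
  rw [h3, Gamma_add_nat hs, Finset.prod_congr rfl fun i _ => Gamma_add_nat hα (a (i : Fin (m + 1))),
    Finset.prod_mul_distrib, polya, Finset.prod_range fun i => rise α (a i),
    Finset.sum_range fun _ => α, Finset.sum_range a]
  have h4 : 0 < ∏ _i : Fin (m + 1), Real.Gamma α := Finset.prod_pos fun _ _ => h2
  have h5 : 0 ≤ ∏ i : Fin (m + 1), rise α (a i) := Finset.prod_nonneg fun i _ => rise_nonneg hα.le _
  have h6 := rise_pos hs (∑ i : Fin (m + 1), a i)
  rw [ENNReal.toReal_ofReal (by positivity)]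
  field_simp

/-! ### Moments determine measures on a cube -/

open BoundedContinuousFunction in
/-- Finite measures on a cube are determined by their moments. -/
lemma measure_eq_of_moments_unitInterval {ι : Type*} [Fintype ι]
    {P Q : Measure (ι → unitInterval)} [IsFiniteMeasure P] [IsFiniteMeasure Q]
    (h : ∀ a : ι → ℕ, ∫ x, ∏ i, (x i : ℝ) ^ a i ∂P = ∫ x, ∏ i, (x i : ℝ) ^ a i ∂Q) : P = Q := by
  let c : ι → ((ι → unitInterval) →ᵇ ℝ) := fun i =>
    BoundedContinuousFunction.mkOfCompact ⟨fun x => (x i : ℝ), by fun_prop⟩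
  -- The polynomial functions form an algebra separating points, so their integrals determine a
  -- finite measure; by linearity monomials suffice.
  let A : StarSubalgebra ℝ ((ι → unitInterval) →ᵇ ℝ) :=
    { (MvPolynomial.aeval c : MvPolynomial ι ℝ →ₐ[ℝ] _).range with
      star_mem' := fun {g} hg => by
        have : star g = g := by ext x; simp
        rw [this]
        exact hg }
  have hA : ∀ g, g ∈ A ↔ ∃ p : MvPolynomial ι ℝ, MvPolynomial.aeval c p = g := fun g => Iff.rfl
  refine ext_of_forall_mem_subalgebra_integral_eq_of_polish (𝕜 := ℝ) (A := A) ?_ ?_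
  · intro x y hxy
    obtain ⟨i, hi⟩ := Function.ne_iff.1 hxy
    refine ⟨_, ⟨_, ⟨c i, (hA _).2 ⟨MvPolynomial.X i, MvPolynomial.aeval_X _ _⟩, rfl⟩, rfl⟩, ?_⟩
    simpa [c, Subtype.ext_iff] using hi
  · intro g hg
    obtain ⟨p, rfl⟩ := (hA g).1 hg
    induction p using MvPolynomial.induction_on' with
    | monomial s r =>
      have : ∀ x, (MvPolynomial.aeval c (MvPolynomial.monomial s r)) x =
          r * ∏ i, (x i : ℝ) ^ s i := by
        intro x
        rw [MvPolynomial.aeval_monomial, Finsupp.prod_fintype _ _ (by simp)]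
        simp [c, Algebra.algebraMap_eq_smul_one]
      simp_rw [this, integral_const_mul, h]
    | add p q hp hq =>
      have hi : ∀ (ν : Measure (ι → unitInterval)) [IsFiniteMeasure ν]
          (f : (ι → unitInterval) →ᵇ ℝ), Integrable f ν := fun ν _ f => f.integrable ν
      simp only [map_add, BoundedContinuousFunction.coe_add, Pi.add_apply]
      rw [integral_add (hi _ _) (hi _ _), integral_add (hi _ _) (hi _ _),
        hp ((hA _).2 ⟨p, rfl⟩), hq ((hA _).2 ⟨q, rfl⟩)]

/-- Projecting each coordinate onto the unit interval and including it back changes nothing almost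
everywhere, which reduces the claim to the compact cube. -/
lemma measure_eq_of_moments {ι : Type*} [Fintype ι] {P Q : Measure (ι → ℝ)} [IsFiniteMeasure P]
    [IsFiniteMeasure Q] (hP : ∀ᵐ x ∂P, ∀ i, x i ∈ Set.Icc (0 : ℝ) 1)
    (hQ : ∀ᵐ x ∂Q, ∀ i, x i ∈ Set.Icc (0 : ℝ) 1)
    (h : ∀ a : ι → ℕ, ∫ x, ∏ i, x i ^ a i ∂P = ∫ x, ∏ i, x i ^ a i ∂Q) : P = Q := by
  let r : (ι → ℝ) → ι → unitInterval := fun x i => Set.projIcc 0 1 zero_le_one (x i)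
  let e : (ι → unitInterval) → ι → ℝ := fun x i => x i
  have hr : Measurable r := (by fun_prop : Continuous r).measurable
  have he : Measurable e := (by fun_prop : Continuous e).measurable
  have her : ∀ x : ι → ℝ, (∀ i, x i ∈ Set.Icc (0 : ℝ) 1) → e (r x) = x := by
    intro x hx
    funext i
    simp only [e, r]
    rw [Set.projIcc_of_mem _ (hx i)]
  have hback : ∀ ν : Measure (ι → ℝ), (∀ᵐ x ∂ν, ∀ i, x i ∈ Set.Icc (0 : ℝ) 1) →
      (ν.map r).map e = ν := by
    intro ν hν
    rw [Measure.map_map he hr, Measure.map_congr (f := e ∘ r) (g := id) (hν.mono fun x hx => her x hx),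
      Measure.map_id]
  have hmom : ∀ ν : Measure (ι → ℝ), (∀ᵐ x ∂ν, ∀ i, x i ∈ Set.Icc (0 : ℝ) 1) → ∀ a : ι → ℕ,
      ∫ x, ∏ i, (x i : ℝ) ^ a i ∂ν.map r = ∫ x, ∏ i, x i ^ a i ∂ν := by
    intro ν hν a
    rw [integral_map hr.aemeasurable
      (by fun_prop : Continuous fun x : ι → unitInterval => ∏ i, (x i : ℝ) ^ a i).aestronglyMeasurable]
    refine integral_congr_ae (hν.mono fun x hx => ?_)
    exact Finset.prod_congr rfl fun i _ => congrArg (· ^ a i) (congrFun (her x hx) i)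
  rw [← hback P hP, ← hback Q hQ]
  congr 1
  exact measure_eq_of_moments_unitInterval fun a => by rw [hmom P hP, hmom Q hQ, h]

lemma measure_eq_of_moments_sigma {ι : Type*} [Fintype ι] {k : ι → ℕ}
    {P Q : Measure (∀ i, Fin (k i) → ℝ)} [IsFiniteMeasure P] [IsFiniteMeasure Q]
    (hP : ∀ᵐ x ∂P, ∀ i j, x i j ∈ Set.Icc (0 : ℝ) 1)
    (hQ : ∀ᵐ x ∂Q, ∀ i j, x i j ∈ Set.Icc (0 : ℝ) 1)
    (h : ∀ a : ∀ i, Fin (k i) → ℕ,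
      ∫ x, ∏ i, ∏ j, x i j ^ a i j ∂P = ∫ x, ∏ i, ∏ j, x i j ^ a i j ∂Q) : P = Q := by
  let e := (MeasurableEquiv.piCurry fun (i : ι) (_ : Fin (k i)) => ℝ).symm
  have hsupp : ∀ ν : Measure (∀ i, Fin (k i) → ℝ), (∀ᵐ x ∂ν, ∀ i j, x i j ∈ Set.Icc (0 : ℝ) 1) →
      ∀ᵐ x ∂ν.map e, ∀ p, x p ∈ Set.Icc (0 : ℝ) 1 := by
    intro ν hν
    rw [ae_map_iff e.measurable.aemeasurable]
    · exact hν.mono fun x hx p => hx p.1 p.2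
    · simp_rw [Set.ofPred_forall]
      exact MeasurableSet.iInter fun p => measurable_pi_apply p measurableSet_Icc
  have := Measure.isFiniteMeasure_map P e
  have := Measure.isFiniteMeasure_map Q e
  refine e.map_measurableEquiv_injective ?_
  refine measure_eq_of_moments (hsupp P hP) (hsupp Q hQ) fun a => ?_
  rw [integral_map_equiv, integral_map_equiv]
  simp_rw [Fintype.prod_sigma]
  exact h fun i j => a ⟨i, j⟩

/-! ### Independence and Dirichlet laws -/

section

variable {Ω : Type*} [MeasurableSpace Ω] {μ : Measure Ω} [IsProbabilityMeasure μ] {d : ℕ}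
  {T : ℕ → Ω → Finset Word} {V : ℕ → Ω → Word}

lemma arity_pos {d : ℕ} (hd : 2 ≤ d) (u : Word) : 0 < arity d u := by
  unfold arity
  split_ifs <;> omega

lemma IsRegularUA.aemeasurable_limitRatios (hT : IsRegularUA μ d T V) (hd : 2 ≤ d) (k : ℕ)
    (u : Word) : AEMeasurable (limitRatios T k u) μ :=
  aemeasurable_pi_lambda _ fun _ => hT.aemeasurable_limitRatio hd (by simp)

lemma IsRegularUA.ae_limitRatios_mem_Icc (hT : IsRegularUA μ d T V) (hd : 2 ≤ d) :
    ∀ᵐ ω ∂μ, ∀ (k : ℕ) (u : Word) (i : Fin k), limitRatios T k u ω i ∈ Set.Icc (0 : ℝ) 1 := by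
  have h : ∀ᵐ ω ∂μ, ∀ (u : Word) (i : ℕ+), limitRatio T (u ++ [i]) ω ∈ Set.Icc (0 : ℝ) 1 :=
    ae_all_iff.2 fun u => ae_all_iff.2 fun i => hT.ae_limitRatio_mem_Icc hd (by simp)
  filter_upwards [h] with ω hω k u i using hω u _

/-- The limiting proportions below finitely many words have the law of independent Dirichlet
vectors. -/
lemma IsRegularUA.map_limitRatios (hT : IsRegularUA μ d T V) (hd : 2 ≤ d)
    (S : Finset (regularWords d)) :
    μ.map (fun ω (u : S) => limitRatios T (arity d u.1.1) u.1.1 ω) =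
      Measure.pi fun u : S => symmDirichlet (arity d u.1.1) (1 / ((d : ℝ) - 1)) := by
  classical
  have hα : 0 < 1 / ((d : ℝ) - 1) := by
    have : (2 : ℝ) ≤ d := by exact_mod_cast hd
    exact one_div_pos.2 (by linarith)
  have hX : AEMeasurable (fun ω (u : S) => limitRatios T (arity d u.1.1) u.1.1 ω) μ :=
    aemeasurable_pi_lambda _ fun u => hT.aemeasurable_limitRatios hd _ _
  have hprob : ∀ u : S,
      IsProbabilityMeasure (symmDirichlet (arity d u.1.1) (1 / ((d : ℝ) - 1))) := fun u =>
    isProbabilityMeasure_symmDirichlet (arity_pos hd _) hα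
  have := Measure.isProbabilityMeasure_map hX
  refine measure_eq_of_moments_sigma ?_ ?_ fun a => ?_
  · rw [ae_map_iff hX]
    · exact (hT.ae_limitRatios_mem_Icc hd).mono fun ω hω u i => hω _ _ _
    · simp_rw [Set.ofPred_forall]
      exact MeasurableSet.iInter fun u => MeasurableSet.iInter fun i =>
        (measurable_pi_apply i).comp (measurable_pi_apply u) measurableSet_Icc
  · exact ae_all_iff.2 fun u =>
      (Measure.tendsto_eval_ae_ae
        (μ := fun u : S => symmDirichlet (arity d u.1.1) (1 / ((d : ℝ) - 1))) (i := u)).eventually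
        (ae_symmDirichlet_mem_Icc (arity_pos hd _) _)
  -- The exponents `a` are extended by `0` to all words and all indices, the form used by
  -- `integral_prod_limitRatio`. The chosen element of `S` is determined by its word, so `b`
  -- restricts to `a`.
  · let b : Word → ℕ → ℕ := fun w i =>
      if h : ∃ u : S, u.1.1 = w ∧ i < arity d u.1.1 then a h.choose ⟨i, h.choose_spec.2⟩ else 0
    have hb : ∀ (u : S) (i : Fin (arity d u.1.1)), b u.1.1 i = a u i := by
      intro u i
      have h : ∃ u' : S, u'.1.1 = u.1.1 ∧ (i : ℕ) < arity d u'.1.1 := ⟨u, rfl, i.2⟩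
      have key : ∀ (u' : S) (hu' : u'.1.1 = u.1.1) (hi : (i : ℕ) < arity d u'.1.1),
          a u' ⟨i, hi⟩ = a u i := by
        intro u' hu' hi
        obtain rfl : u' = u := Subtype.ext (Subtype.ext hu')
        rfl
      simp only [b, dif_pos h]
      exact key _ h.choose_spec.1 h.choose_spec.2
    have hS : ∀ w ∈ S.image Subtype.val, w ∈ regularWords d := by
      intro w hw
      obtain ⟨u, -, rfl⟩ := Finset.mem_image.1 hw
      exact u.2
    have hprod : ∀ f : Word → ℝ, ∏ w ∈ S.image Subtype.val, f w = ∏ u : S, f u.1.1 := by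
      intro f
      rw [Finset.prod_image Subtype.val_injective.injOn, ← Finset.prod_coe_sort]
    have hmom := hT.integral_prod_limitRatio hd hS b
    simp_rw [hprod, Finset.prod_range] at hmom
    rw [integral_map hX (Measurable.aestronglyMeasurable (by fun_prop)),
      integral_fintype_prod_eq_prod
        (f := fun (u : S) (x : Fin (arity d u.1.1) → ℝ) => ∏ i, x i ^ a u i)]
    simp_rw [← hb]
    rw [Finset.prod_congr rfl fun u _ => integral_symmDirichlet (arity_pos hd _) hα (b u.1.1)]
    exact hmom

lemma IsRegularUA.hasLaw_limitRatios (hT : IsRegularUA μ d T V) (hd : 2 ≤ d) {u : Word}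
    (hu : u ∈ regularWords d) : HasLaw (limitRatios T (arity d u) u)
      (symmDirichlet (arity d u) (1 / ((d : ℝ) - 1))) μ := by
  have hα : 0 < 1 / ((d : ℝ) - 1) := by
    have : (2 : ℝ) ≤ d := by exact_mod_cast hd
    exact one_div_pos.2 (by linarith)
  refine ⟨hT.aemeasurable_limitRatios hd _ _, ?_⟩
  let S : Finset (regularWords d) := {⟨u, hu⟩}
  let u' : S := ⟨⟨u, hu⟩, Finset.mem_singleton_self _⟩
  have hprob : ∀ u : S,
      IsProbabilityMeasure (symmDirichlet (arity d u.1.1) (1 / ((d : ℝ) - 1))) := fun u =>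
    isProbabilityMeasure_symmDirichlet (arity_pos hd _) hα
  have h := congrArg (Measure.map (Function.eval u')) (hT.map_limitRatios hd S)
  rw [(measurePreserving_eval _ u').map_eq, AEMeasurable.map_map_of_aemeasurable
    (measurable_pi_apply u').aemeasurable
    (aemeasurable_pi_lambda _ fun u => hT.aemeasurable_limitRatios hd _ _)] at h
  exact h

lemma IsRegularUA.iIndepFun_limitRatios (hT : IsRegularUA μ d T V) (hd : 2 ≤ d) :
    iIndepFun (fun u : regularWords d => limitRatios T (arity d u) u) μ := by
  refine iIndepFun_iff_finset.2 fun S => ?_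
  refine (iIndepFun_iff_map_fun_eq_pi_map fun u : S =>
    hT.aemeasurable_limitRatios hd (arity d u.1.1) u.1.1).2 ?_
  refine (hT.map_limitRatios hd S).trans ?_
  congr 1
  funext u
  exact (hT.hasLaw_limitRatios hd u.1.2).map_eq.symm

end

end UniformAttachment

theorem mainTheorem9 {Ω : Type*} [MeasurableSpace Ω] (μ : Measure Ω) [IsProbabilityMeasure μ]
    (d : ℕ) (hd : 2 ≤ d) (T : ℕ → Ω → Finset UniformAttachment.Word)
    (V : ℕ → Ω → UniformAttachment.Word) (hT : UniformAttachment.IsRegularUA μ d T V) :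
    (∀ v : UniformAttachment.Word, v ≠ [] → ∀ᵐ ω ∂μ,
      Tendsto (fun n => UniformAttachment.ratio v (T n ω)) atTop
        (𝓝 (UniformAttachment.limitRatio T v ω))) ∧
    iIndepFun (fun (u : UniformAttachment.regularWords d) =>
      UniformAttachment.limitRatios T (UniformAttachment.arity d u) u) μ ∧
    HasLaw (UniformAttachment.limitRatios T (d + 1) [])
      (UniformAttachment.symmDirichlet (d + 1) (1 / ((d : ℝ) - 1))) μ ∧
    ∀ u ∈ UniformAttachment.regularWords d, u ≠ [] →
      HasLaw (UniformAttachment.limitRatios T d u)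
        (UniformAttachment.symmDirichlet d (1 / ((d : ℝ) - 1))) μ := by
  refine ⟨fun v hv => hT.ae_tendsto_ratio hd hv, hT.iIndepFun_limitRatios hd, ?_, ?_⟩
  · exact hT.hasLaw_limitRatios hd (u := []) (by simp [UniformAttachment.regularWords])
  · intro u hu hu0
    have h := hT.hasLaw_limitRatios hd hu
    rwa [UniformAttachment.arity, if_neg hu0] at h
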